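/- **Setting.** Let $n, d\ge 1$ and let $(\{1,\dots,n\},\mathcal E)$ be a weakly connected directed graph. Let each edge $(i,j)\in\mathcal E$ carry a relative measurement $(\tilde R_{ij},\tilde t_{ij})\in \mathrm{SO}(d)\times\mathbb R^d$ and weights $\kappa_{ij},\tau_{ij}>0$. Write $X=[Y_1\ p_1\ \cdots\ Y_n\ p_n]\in\mathbb R^{r\times(d+1)n}$ with $Y_i\in\mathbb R^{r\times d}$, $p_i\in\mathbb R^r$. Let $Q$ be the connection Laplacian, that is, the symmetric matrix with $$f(X):=\langle Q,X^\top X\rangle=\sum_{(i,j)\in\mathcal E}\kappa_{ij}\|Y_j-Y_i\tilde R_{ij}\|_F^2+\tau_{ij}\|p_j-p_i-Y_i\tilde t_{ij}\|_2^2$$ for all $r$ and $X$. Let $f^\star_{\rm SDP}$ be the optimal value of the SDP: minimize $\langle Q,Z\rangle$ over $Z\succeq0$ for which the leading $d\times d$ part of every diagonal $(d+1)\times(d+1)$ block is $I_d$. Let $\mathcal M(r)=\{X: Y_i^\top Y_i=I_d\ \forall i\}\subset\mathbb R^{r\times(d+1)n}$, with the Frobenius metric. Let $S(X)=Q-\Lambda(X)$,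 where $\Lambda(X)$ is obtained from $X^\top XQ$ by replacing the leading $d\times d$ part of every diagonal block by its symmetric part and all other entries by $0$. **Algorithm.** Start from $X_0\in\mathcal M(r_0)$. For $r=r_0,r_0+1,\dots$: 1. Local search from the current point of $\mathcal M(r)$ returns a first-order critical point of $f$ on $\mathcal M(r)$ at which $f$ is not larger than at the current point (as Riemannian block-coordinate descent does; any such output is allowed). 2. Append a zero row to this critical point, which gives $X^{(r)}\in\mathcal M(r+1)$. 3. Let $\lambda=\lambda_{\min}(S(X^{(r)}))$. If $\lambda\ge0$, stop and return $X^{(r)}$. 4. Otherwise take a unit eigenvector $v$ of $S(X^{(r)})$ for $\lambda$. Let $\dot X$ be the matrix with last row $v^\top$ and all other rows $0$. Continue at rank $r+1$ from the point $\exp_{X^{(r)}}(t\dot X)$ on the geodesic of $\mathcal M(r+1)$, with $t=\min\{-4\lambda/\kappa,\ \tau\}$. Here $\tau>0$ is any fixed constant, and $\kappa>0$ is any fixed constant with $$\kappa\ \ge\ 4\|Q\|_F\sqrt{dn+c_f/\lambda_2(L)}+4c_s\sqrt{dn},\qquad c_f=|\mathcal E|\Bigl(\sqrt{\bar f/\min_{\mathcal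 E}\tau_{ij}}+\max_{\mathcal E}\|\tilde t_{ij}\|_2\Bigr)^2,\qquad \bar f=f(X^{(r_0)}).$$ In this formula $L=\sum_{(i,j)\in\mathcal E}(e_i-e_j)(e_i-e_j)^\top$ is the unweighted graph Laplacian, $\lambda_2(L)$ is its smallest positive eigenvalue (for $n=1$ the term $c_f/\lambda_2(L)$ is read as $0$), and $c_s$ is the supremum of $\|S(X)\|_F$ over all $r$ and all $X\in\mathcal M(r)$ with $f(X)\le\bar f$. **Theorem.** For every run of the algorithm, exactly one of the following holds. (i) The algorithm stops after finitely many iterations and returns a factor $X^{(r)}$ such that $Z^\star=(X^{(r)})^\top X^{(r)}$ is a minimizer of the SDP. (ii) The algorithm never stops; $f(X^{(r')})<f(X^{(r)})$ for all $r'>r\ge r_0$; $\lim_{r\to\infty}f(X^{(r)})=f^\star_{\rm SDP}$; and there is an infinite subsequence $X^{(r_k)}$ with $\lim_{k\to\infty}\lambda_{\min}(S(X^{(r_k)}))=0$. -/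

import Mathlib

noncomputable section

namespace PGO

/-- Frobenius inner product of real matrices. -/
def frob {m l : Type*} [Fintype m] [Fintype l] (A B : Matrix m l ℝ) : ℝ :=
  (A.transpose * B).trace

/-- Frobenius norm. -/
def frobNorm {m l : Type*} [Fintype m] [Fintype l] (A : Matrix m l ℝ) : ℝ :=
  Real.sqrt (frob A A)

/-- Columns of the `(d+1)`-block structure: `(i, a)` is column `a` of block `i`. In each block the
first `d` columns (`Fin.castSucc a`) are rotational, the last one (`Fin.last d`) translational. -/
abbrev Col (d n : ℕ) : Type := Fin n × Fin (d + 1)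

/-- A factor `X = [Y₁ p₁ ⋯ Yₙ pₙ]` with `r` rows. -/
abbrev Factor (r d n : ℕ) : Type := Matrix (Fin r) (Col d n) ℝ

/-- The block `Yᵢ` of a factor. -/
def Factor.rotBlock {r d n : ℕ} (X : Factor r d n) (i : Fin n) : Matrix (Fin r) (Fin d) ℝ :=
  Matrix.of fun a b => X a (i, Fin.castSucc b)

/-- The column `pᵢ` of a factor. -/
def Factor.trBlock {r d n : ℕ} (X : Factor r d n) (i : Fin n) : Fin r → ℝ :=
  fun a => X a (i, Fin.last d)

/-- A pose graph in dimension `d` on `n` poses: weakly connected, with relative measurements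
`(rot i j, trans i j) ∈ SE(d)` of positive weights on its directed edges. Values off the edge set
are never used. -/
structure PoseGraph (d n : ℕ) where
  edges : Finset (Fin n × Fin n)
  rot : Fin n → Fin n → Matrix (Fin d) (Fin d) ℝ
  trans : Fin n → Fin n → EuclideanSpace ℝ (Fin d)
  wRot : Fin n → Fin n → ℝ
  wTrans : Fin n → Fin n → ℝ
  rot_mem : ∀ i j, (i, j) ∈ edges → rot i j ∈ Matrix.specialOrthogonalGroup (Fin d) ℝ
  wRot_pos : ∀ i j, (i, j) ∈ edges → 0 < wRot i j
  wTrans_pos : ∀ i j, (i, j) ∈ edges → 0 < wTrans i j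
  connected : (SimpleGraph.fromRel fun i j => (i, j) ∈ edges).Connected

/-- The matrix with `X * selRot i = Yᵢ`. -/
def selRot {d n : ℕ} (i : Fin n) : Matrix (Col d n) (Fin d) ℝ :=
  Matrix.of fun c b => if c = (i, Fin.castSucc b) then 1 else 0

/-- The vector with `X *ᵥ selTr i = pᵢ`. -/
def selTr {d n : ℕ} (i : Fin n) : Col d n → ℝ :=
  fun c => if c = (i, Fin.last d) then 1 else 0

/-- The operator `SymBlockDiag_d⁺`: keep the symmetric parts of the leading `d × d` parts of the
diagonal blocks, and replace all other entries by zero. -/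
def symBlockDiagPlus {d n : ℕ} (Z : Matrix (Col d n) (Col d n) ℝ) :
    Matrix (Col d n) (Col d n) ℝ :=
  Matrix.of fun c c' =>
    if c.1 = c'.1 ∧ c.2 ≠ Fin.last d ∧ c'.2 ≠ Fin.last d then (Z c c' + Z c' c) / 2 else 0

/-- The manifold `M_PGO(r, n) = (St(d, r) × ℝ^r)^n`. -/
def manifold (r d n : ℕ) : Set (Factor r d n) :=
  {X | ∀ i, (X.rotBlock i).transpose * X.rotBlock i = 1}

/-- The tangent space of `M_PGO(r, n)` at `X`. -/
def tangentSpace {r d n : ℕ} (X : Factor r d n) : Set (Factor r d n) :=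
  {V | symBlockDiagPlus (V.transpose * X) = 0}

/-- The least eigenvalue of a symmetric real matrix. -/
def minEig {m : Type*} [Fintype m] [DecidableEq m] (S : Matrix m m ℝ) : ℝ :=
  sInf {μ : ℝ | Module.End.HasEigenvalue (Matrix.toLin' S) μ}

/-- The lifted factor, a row of zeros being appended. -/
def lift {r d n : ℕ} (X : Factor r d n) : Factor (r + 1) d n :=
  Fin.snoc (α := fun _ => Col d n → ℝ) X 0

/-- The matrix whose last row is `v`, all others being zero. -/
def lastRow (r : ℕ) {d n : ℕ} (v : Col d n → ℝ) : Factor (r + 1) d n :=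
  Fin.snoc (α := fun _ => Col d n → ℝ) (0 : Factor r d n) v

/-- `γ` is the geodesic of `M_PGO(r, n)`, for the metric induced by the Frobenius inner product,
with `γ 0 = X` and initial velocity `V`: a curve in the manifold whose acceleration is at every
time orthogonal to the tangent space. Thus `γ t = exp_X (t V)`. -/
def IsGeodesicFrom {r d n : ℕ} (X V : Factor r d n) (γ : ℝ → Factor r d n) : Prop :=
  ∃ vel acc : ℝ → Factor r d n,
    (∀ t, γ t ∈ manifold r d n) ∧
    (∀ t a c, HasDerivAt (fun s => γ s a c) (vel t a c) t) ∧
    (∀ t a c, HasDerivAt (fun s => vel s a c) (acc t a c) t) ∧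
    (∀ t, ∀ η ∈ tangentSpace (γ t), frob (acc t) η = 0) ∧
    γ 0 = X ∧ vel 0 = V

theorem mul_selRot {r d n : ℕ} (X : Factor r d n) (i : Fin n) :
    X * (selRot i : Matrix (Col d n) (Fin d) ℝ) = X.rotBlock i := by
  ext a b
  simp [Matrix.mul_apply, selRot, Factor.rotBlock]

theorem mulVec_selTr {r d n : ℕ} (X : Factor r d n) (i : Fin n) :
    X.mulVec (selTr i) = X.trBlock i := by
  ext a
  simp [Matrix.mulVec, dotProduct, selTr, Factor.trBlock]

namespace PoseGraph

variable {d n : ℕ} (G : PoseGraph d n)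

/-- The connection Laplacian `Q`: the symmetric matrix of the quadratic form
`∑ κᵢⱼ ‖Yⱼ - Yᵢ Rᵢⱼ‖² + τᵢⱼ ‖pⱼ - pᵢ - Yᵢ tᵢⱼ‖²` in the rows of `X`. -/
def Q : Matrix (Col d n) (Col d n) ℝ :=
  ∑ e ∈ G.edges,
    (G.wRot e.1 e.2 •
        ((selRot e.2 - selRot e.1 * G.rot e.1 e.2) *
          (selRot e.2 - selRot e.1 * G.rot e.1 e.2).transpose) +
      G.wTrans e.1 e.2 •
        Matrix.vecMulVec
          (selTr e.2 - selTr e.1 - (selRot e.1).mulVec (G.trans e.1 e.2))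
          (selTr e.2 - selTr e.1 - (selRot e.1).mulVec (G.trans e.1 e.2)))

/-- The objective `f(X) = ⟨Q, Xᵀ X⟩` of the rank-restricted problem. -/
def cost {r : ℕ} (X : Factor r d n) : ℝ :=
  frob G.Q (X.transpose * X)

/-- The Euclidean gradient of `f` at `X`. -/
def euclGrad {r : ℕ} (X : Factor r d n) : Factor r d n :=
  (2 : ℝ) • (X * G.Q)

/-- The objective in terms of the blocks of the factor. -/
theorem cost_eq {r : ℕ} (X : Factor r d n) :
    G.cost X = ∑ e ∈ G.edges,
      (G.wRot e.1 e.2 *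
          frobNorm (X.rotBlock e.2 - X.rotBlock e.1 * G.rot e.1 e.2) ^ 2 +
        G.wTrans e.1 e.2 *
          ∑ a, (X.trBlock e.2 a - X.trBlock e.1 a -
            (X.rotBlock e.1).mulVec (G.trans e.1 e.2) a) ^ 2) := by
  have hpos : ∀ {m l : ℕ} (A : Matrix (Fin m) (Fin l) ℝ), frobNorm A ^ 2 = frob A A := by
    intro m l A
    refine Real.sq_sqrt ?_
    simp only [frob, Matrix.trace, Matrix.diag, Matrix.mul_apply, Matrix.transpose_apply]
    exact Finset.sum_nonneg fun _ _ => Finset.sum_nonneg fun _ _ => mul_self_nonneg _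
  unfold cost Q
  simp only [frob, Matrix.transpose_sum, Finset.sum_mul, Matrix.trace_sum]
  refine Finset.sum_congr rfl fun e _ => ?_
  rw [Matrix.transpose_add, Matrix.add_mul, Matrix.trace_add, Matrix.transpose_smul,
    Matrix.transpose_smul, Matrix.smul_mul, Matrix.smul_mul, Matrix.trace_smul, Matrix.trace_smul,
    hpos, smul_eq_mul, smul_eq_mul]
  congr 2
  · rw [← mul_selRot, ← mul_selRot, Matrix.mul_assoc, ← Matrix.mul_sub, frob,
      Matrix.transpose_mul, Matrix.transpose_mul, Matrix.transpose_transpose, Matrix.mul_assoc,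
      Matrix.trace_mul_comm]
    simp only [Matrix.mul_assoc]
    rfl
  · set b := selTr e.2 - selTr e.1 - (selRot e.1).mulVec (G.trans e.1 e.2).ofLp with hb
    have h1 : ∀ a, (X.trBlock e.2 a - X.trBlock e.1 a -
            (X.rotBlock e.1).mulVec (G.trans e.1 e.2) a) = X.mulVec b a := by
      intro a
      rw [hb, Matrix.mulVec_sub, Matrix.mulVec_sub, Matrix.mulVec_mulVec, mul_selRot,
        mulVec_selTr, mulVec_selTr]
      rfl
    simp only [h1]
    rw [Matrix.transpose_vecMulVec, Matrix.trace_mul_comm, Matrix.mul_vecMulVec,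
      Matrix.trace_vecMulVec, ← Matrix.mulVec_mulVec, dotProduct_comm,
      Matrix.dotProduct_mulVec, Matrix.vecMul_transpose, dotProduct]
    exact Finset.sum_congr rfl fun a _ => (sq _).symm

theorem Q_isSymm : G.Q.transpose = G.Q := by
  simp [Q, Matrix.transpose_sum, Matrix.transpose_vecMulVec]

/-- `euclGrad` is the gradient of the objective. -/
theorem hasDerivAt_cost {r : ℕ} (X V : Factor r d n) :
    HasDerivAt (fun s : ℝ => G.cost (X + s • V)) (frob (G.euclGrad X) V) 0 := by
  have hA : frob G.Q (X.transpose * V) = frob (X * G.Q) V := by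
    simp only [frob, Matrix.transpose_mul, Q_isSymm, Matrix.mul_assoc]
  have hB : frob G.Q (V.transpose * X) = frob (X * G.Q) V := by
    rw [← hA]
    simp only [frob, Q_isSymm]
    rw [← Matrix.trace_transpose, Matrix.transpose_mul, Q_isSymm, Matrix.transpose_mul,
      Matrix.transpose_transpose, Matrix.trace_mul_comm]
  have h : (fun s : ℝ => G.cost (X + s • V)) = fun s =>
      G.cost X + s * frob (G.euclGrad X) V + s ^ 2 * G.cost V := by
    funext s
    have : frob (G.euclGrad X) V = frob G.Q (X.transpose * V) + frob G.Q (V.transpose * X) := by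
      rw [hA, hB]; simp [frob, euclGrad]; ring
    rw [this]
    simp only [cost, frob, Matrix.transpose_add, Matrix.transpose_smul, Matrix.add_mul,
      Matrix.mul_add, Matrix.smul_mul, Matrix.mul_smul, Matrix.trace_add, Matrix.trace_smul,
      smul_eq_mul]
    ring
  rw [h]
  have h1 := ((hasDerivAt_id (0:ℝ)).mul_const (frob (G.euclGrad X) V)).const_add (G.cost X)
  have h2 := ((hasDerivAt_pow 2 (0:ℝ)).mul_const (G.cost V))
  have h3 := h1.add h2
  simp only [one_mul, Nat.cast_ofNat] at h3
  refine (h3.congr_deriv ?_)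
  simp

/-- First-order critical points of `f` on `M_PGO(r, n)`: the orthogonal projection of the Euclidean
gradient onto the tangent space vanishes. -/
def IsCritical {r : ℕ} (X : Factor r d n) : Prop :=
  X ∈ manifold r d n ∧ ∀ η ∈ tangentSpace X, frob (G.euclGrad X) η = 0

/-- The certificate matrix `S(X) = Q - SymBlockDiag_d⁺(Xᵀ X Q)`. -/
def cert {r : ℕ} (X : Factor r d n) : Matrix (Col d n) (Col d n) ℝ :=
  G.Q - symBlockDiagPlus (X.transpose * X * G.Q)

/-- The feasible set of the SDP relaxation. -/
def sdpFeasible (d n : ℕ) : Set (Matrix (Col d n) (Col d n) ℝ) :=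
  {Z | Z.PosSemidef ∧ ∀ (i : Fin n) (a b : Fin d),
    Z (i, Fin.castSucc a) (i, Fin.castSucc b) = if a = b then 1 else 0}

/-- `Z` is a minimizer of the SDP relaxation. -/
def IsSDPMinimizer (Z : Matrix (Col d n) (Col d n) ℝ) : Prop :=
  Z ∈ sdpFeasible d n ∧ ∀ Z' ∈ sdpFeasible d n, frob G.Q Z ≤ frob G.Q Z'

/-- The optimal value of the SDP relaxation (an infimum of a nonempty set of nonnegative
numbers). -/
def sdpValue : ℝ :=
  sInf ((fun Z => frob G.Q Z) '' sdpFeasible d n)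

/-- The unweighted graph Laplacian, `pᵀ L p = ∑ (pⱼ - pᵢ)²` over the directed edges `(i, j)`. -/
def laplacian : Matrix (Fin n) (Fin n) ℝ :=
  ∑ e ∈ G.edges,
    Matrix.vecMulVec (Pi.single e.2 1 - Pi.single e.1 1) (Pi.single e.2 1 - Pi.single e.1 1)

/-- The algebraic connectivity, as the smallest positive eigenvalue of the Laplacian. (For `n = 1`
there is none, the value is `0`, and so are the quotients by it.) -/
def algConn : ℝ :=
  sInf {μ : ℝ | 0 < μ ∧ Module.End.HasEigenvalue (Matrix.toLin' G.laplacian) μ}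

/-- The constant `c_f` that bounds `∑ ‖pⱼ - pᵢ‖²` on the sublevel set of level `fbar`. -/
def cF (fbar : ℝ) : ℝ :=
  (G.edges.card : ℝ) *
    (Real.sqrt (fbar / sInf ((fun e : Fin n × Fin n => G.wTrans e.1 e.2) '' G.edges)) +
      sSup ((fun e : Fin n × Fin n => ‖G.trans e.1 e.2‖) '' G.edges)) ^ 2

/-- The least constant `c_s` with `‖S(X)‖_F ≤ c_s` for all factors `X` of all ranks in the sublevel
set of level `fbar`. -/
def cS (fbar : ℝ) : ℝ :=
  sSup {s : ℝ | ∃ (r : ℕ) (X : Factor r d n),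
    X ∈ manifold r d n ∧ G.cost X ≤ fbar ∧ s = frobNorm (G.cert X)}

/-- The constant `κ` of the step size rule for the sublevel set of level `fbar`. -/
def kappa (fbar : ℝ) : ℝ :=
  4 * frobNorm G.Q * Real.sqrt (d * n + G.cF fbar / G.algConn) +
    4 * G.cS fbar * Real.sqrt (d * n)

/-- The local search step of the staircase: from the point `X` the local search returns a first-order critical
point `X'` of the problem of the same rank, and does not increase the objective. -/
def LocalSearch {r : ℕ} (X X' : Factor r d n) : Prop :=
  G.IsCritical X' ∧ G.cost X' ≤ G.cost X

/-- The saddle escape from the lifting of `X`: follow the geodesic whose initial velocity has a unit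
eigenvector `v` for the least eigenvalue `λ` of the certificate matrix as its last row and is zero
elsewhere, for the time `min (-4 λ / κ) τ`. The point reached is `X'`. -/
def Escape (κ τ : ℝ) {r : ℕ} (X : Factor r d n) (X' : Factor (r + 1) d n) : Prop :=
  ∃ (v : Col d n → ℝ) (γ : ℝ → Factor (r + 1) d n),
    v ⬝ᵥ v = 1 ∧
    (G.cert (lift X)).mulVec v = minEig (G.cert (lift X)) • v ∧
    IsGeodesicFrom (lift X) (lastRow r v) γ ∧
    X' = γ (min (-4 * minEig (G.cert (lift X)) / κ) τ)

/-- Level `k` is reached: the optimality test failed at all earlier levels. -/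
def Reached {r₀ : ℕ} (crit : ∀ k : ℕ, Factor (r₀ + k) d n) (k : ℕ) : Prop :=
  ∀ j < k, minEig (G.cert (lift (crit j))) < 0

/-- A run of the Riemannian staircase from `X₀`, with parameters `κ`, `τ` of the saddle escape. At
level `k`, that is at rank `r₀ + k`, local search starts from `start k` and returns `crit k`; the
algorithm stops there if the least eigenvalue of the certificate matrix of the lifted point is
nonnegative, and otherwise escapes to `start (k + 1)`. The entries of levels that are not reached
are arbitrary and play no role. -/
structure Run {r₀ : ℕ} (X₀ : Factor r₀ d n) (κ τ : ℝ) where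
  start : ∀ k : ℕ, Factor (r₀ + k) d n
  crit : ∀ k : ℕ, Factor (r₀ + k) d n
  start_zero : start 0 = X₀
  localSearch : ∀ k, G.Reached crit k → G.LocalSearch (start k) (crit k)
  escape : ∀ k, G.Reached crit k → minEig (G.cert (lift (crit k))) < 0 →
    G.Escape κ τ (crit k) (start (k + 1))

variable {G}

/-- The lifted factor `X^(r₀ + k)` generated at level `k`. -/
def Run.X {r₀ : ℕ} {X₀ : Factor r₀ d n} {κ τ : ℝ} (R : G.Run X₀ κ τ) (k : ℕ) :
    Factor (r₀ + k + 1) d n :=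
  lift (R.crit k)

/-- The run stops at level `k` and returns the lifted factor of that level. -/
def Run.ReturnsAt {r₀ : ℕ} {X₀ : Factor r₀ d n} {κ τ : ℝ} (R : G.Run X₀ κ τ) (k : ℕ) : Prop :=
  G.Reached R.crit k ∧ 0 ≤ minEig (G.cert (R.X k))

end PoseGraph

end PGO

end

/-! Two estimates carry the theorem: weak duality that degrades gracefully with the least
eigenvalue, and a guaranteed decrease of the escape step whose constants do not depend on the rank.

Duality (`cost_add_minEig_le`). Criticality says `X * S(X) = 0`. Since `Q = S + Λ` and `Λ` sees only
those blocks of `Z` that the constraints fix, `⟨Q, Z⟩ = ⟨S, Z⟩ + tr Λ` for feasible `Z`, while `f(X)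
= tr Λ`. Hence `f(X) + λ_min(S) * tr Z ≤ ⟨Q, Z⟩`. If `λ_min ≥ 0`, this certifies optimality; if
`λ_min → 0` along a run, it forces the limit of the costs below every `⟨Q, Z⟩`, with `Z` held fixed.

Decrease (`Escape.cost_le`). The initial velocity lies in a new row, so it is orthogonal to the
lifted factor, and the geodesic equation becomes the linear system `γ'' = -γ N` with constant `N =
diag(vᵢ vᵢᵀ)`. It is solved by sines and cosines (`IsGeodesicFrom.gram_eq`). The change of the cost
is then explicit (`cost_geodesic_eq`): the term `λ t²` plus errors of order `t⁴`, controlled by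
`‖S‖` and `‖Q‖` (`cost_geodesic_le`). Because `κ ≥ 4 (‖S‖ + ‖Q‖)` on the initial sublevel set, the
step `t ≤ -4λ/κ` decreases the cost by at least `-λ t² / 4`.

The costs are bounded below, so in an infinite run the decreases tend to zero. This forces `λ_min →
0`, and duality identifies the limit. -/

noncomputable section

namespace PGO

/-! ### Frobenius inner product, positive semidefinite forms and the least eigenvalue -/

section Frobenius

variable {m l : Type*} [Fintype m] [Fintype l]

theorem frob_eq_sum (A B : Matrix m l ℝ) : frob A B = ∑ i, ∑ j, A i j * B i j := by
  simp only [frob, Matrix.trace, Matrix.diag, Matrix.mul_apply, Matrix.transpose_apply]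
  exact Finset.sum_comm

theorem frob_sub_left (A B C : Matrix m l ℝ) : frob (A - B) C = frob A C - frob B C := by
  simp [frob, Matrix.sub_mul]

theorem frob_smul_left (a : ℝ) (A B : Matrix m l ℝ) : frob (a • A) B = a * frob A B := by
  simp [frob]

theorem frob_mul_left {k : Type*} [Fintype k] (X : Matrix m k ℝ) (M : Matrix k l ℝ)
    (B : Matrix m l ℝ) : frob (X * M) B = frob M (X.transpose * B) := by
  simp [frob, Matrix.mul_assoc]

theorem frob_transpose (A B : Matrix m l ℝ) : frob A.transpose B.transpose = frob A B := by
  simp only [frob_eq_sum, Matrix.transpose_apply]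
  exact Finset.sum_comm

theorem frob_self_nonneg (A : Matrix m l ℝ) : 0 ≤ frob A A := by
  rw [frob_eq_sum]
  exact Finset.sum_nonneg fun _ _ => Finset.sum_nonneg fun _ _ => mul_self_nonneg _

theorem eq_zero_of_frob_self {A : Matrix m l ℝ} (h : frob A A = 0) : A = 0 :=
  Matrix.trace_conjTranspose_mul_self_eq_zero_iff.mp h

theorem frobNorm_nonneg (A : Matrix m l ℝ) : 0 ≤ frobNorm A := Real.sqrt_nonneg _

theorem frobNorm_sq (A : Matrix m l ℝ) : frobNorm A ^ 2 = frob A A :=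
  Real.sq_sqrt (frob_self_nonneg A)

theorem dotProduct_self_nonneg_real (x : m → ℝ) : 0 ≤ x ⬝ᵥ x :=
  Finset.sum_nonneg fun _ _ => mul_self_nonneg _

/-- The Frobenius norm bounds the quadratic form of a matrix. -/
theorem abs_dotProduct_mulVec_le (A : Matrix m m ℝ) (x : m → ℝ) :
    |x ⬝ᵥ A.mulVec x| ≤ frobNorm A * (x ⬝ᵥ x) := by
  refine abs_le_of_sq_le_sq ?_ (mul_nonneg (frobNorm_nonneg A) (dotProduct_self_nonneg_real x))
  rw [mul_pow, frobNorm_sq, frob_eq_sum]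
  have h1 : (x ⬝ᵥ A.mulVec x) ^ 2 ≤ (x ⬝ᵥ x) * (A.mulVec x ⬝ᵥ A.mulVec x) := by
    simpa only [dotProduct, sq] using Finset.sum_mul_sq_le_sq_mul_sq Finset.univ x (A.mulVec x)
  have h2 : A.mulVec x ⬝ᵥ A.mulVec x ≤ (∑ i, ∑ j, A i j * A i j) * (x ⬝ᵥ x) := by
    rw [dotProduct, Finset.sum_mul]
    refine Finset.sum_le_sum fun i _ => ?_
    simpa only [Matrix.mulVec, dotProduct, sq] using
      Finset.sum_mul_sq_le_sq_mul_sq Finset.univ (A i) x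
  nlinarith [mul_le_mul_of_nonneg_left h2 (dotProduct_self_nonneg_real x)]

theorem trace_mul_mul_transpose (N : Matrix l m ℝ) (A : Matrix m m ℝ) :
    (N * A * N.transpose).trace = ∑ i, N i ⬝ᵥ A.mulVec (N i) := by
  refine Finset.sum_congr rfl fun i _ => ?_
  rw [Matrix.diag_apply, Matrix.mul_assoc, Matrix.mul_apply, dotProduct]
  refine Finset.sum_congr rfl fun j _ => ?_
  rfl

theorem trace_mul_transpose (N : Matrix l m ℝ) :
    (N * N.transpose).trace = ∑ i, N i ⬝ᵥ N i := rfl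

theorem trace_mul_mul_transpose_le (N : Matrix l m ℝ) (A : Matrix m m ℝ) :
    (N * A * N.transpose).trace ≤ frobNorm A * (N * N.transpose).trace := by
  rw [trace_mul_mul_transpose, trace_mul_transpose, Finset.mul_sum]
  exact Finset.sum_le_sum fun i _ => (le_abs_self _).trans (abs_dotProduct_mulVec_le A (N i))

theorem frob_vecMulVec (A : Matrix m m ℝ) (x : m → ℝ) :
    frob A (Matrix.vecMulVec x x) = x ⬝ᵥ A.mulVec x := by
  simp only [frob_eq_sum, Matrix.vecMulVec_apply, dotProduct, Matrix.mulVec, Finset.mul_sum]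
  exact Finset.sum_congr rfl fun _ _ => Finset.sum_congr rfl fun _ _ => by ring

/-- Cauchy–Schwarz for a positive semidefinite form. -/
theorem sq_dotProduct_mulVec_le {A : Matrix m m ℝ} (hA : A.PosSemidef) (x y : m → ℝ) :
    (x ⬝ᵥ A.mulVec y) ^ 2 ≤ (x ⬝ᵥ A.mulVec x) * (y ⬝ᵥ A.mulVec y) := by
  have hs : y ⬝ᵥ A.mulVec x = x ⬝ᵥ A.mulVec y := by
    have hT : A.transpose = A := hA.isHermitian
    rw [dotProduct_comm, ← Matrix.vecMul_transpose, hT, Matrix.dotProduct_mulVec]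
  have h : ∀ s : ℝ, 0 ≤ (y ⬝ᵥ A.mulVec y) * (s * s) + (2 * (x ⬝ᵥ A.mulVec y)) * s
      + x ⬝ᵥ A.mulVec x := by
    intro s
    have := hA.dotProduct_mulVec_nonneg (x + s • y)
    simp only [star_trivial, Matrix.mulVec_add, Matrix.mulVec_smul, add_dotProduct,
      dotProduct_add, smul_dotProduct, dotProduct_smul, smul_eq_mul, hs] at this
    linarith
  have := discrim_le_zero h
  rw [discrim] at this
  nlinarith

theorem posSemidef_of_dotProduct {A : Matrix m m ℝ} (hA : A.transpose = A)
    (h : ∀ x : m → ℝ, 0 ≤ x ⬝ᵥ A.mulVec x) : A.PosSemidef :=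
  Matrix.posSemidef_iff_dotProduct_mulVec.mpr ⟨hA, fun x => by simpa using h x⟩

open scoped MatrixOrder Matrix.Norms.L2Operator in
/-- The Frobenius inner product of positive semidefinite matrices is nonnegative. -/
theorem frob_nonneg_of_posSemidef [DecidableEq m] {A Z : Matrix m m ℝ} (hA : A.PosSemidef)
    (hZ : Z.PosSemidef) : 0 ≤ frob A Z := by
  obtain ⟨B, rfl⟩ := CStarAlgebra.nonneg_iff_eq_star_mul_self.mp
    (Matrix.nonneg_iff_posSemidef.mpr hZ)
  have hT : A.transpose = A := hA.isHermitian
  have h : frob A (star B * B) = (B * A * B.transpose).trace := by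
    rw [frob, hT, ← Matrix.mul_assoc, Matrix.trace_mul_comm, Matrix.mul_assoc]
    rfl
  rw [h, trace_mul_mul_transpose]
  exact Finset.sum_nonneg fun i _ => by simpa using hA.dotProduct_mulVec_nonneg (B i)

variable [DecidableEq m]

theorem minEig_le_of_hasEigenvalue {S : Matrix m m ℝ} {μ : ℝ}
    (h : Module.End.HasEigenvalue (Matrix.toLin' S) μ) : minEig S ≤ μ :=
  csInf_le (Module.End.finite_hasEigenvalue _).bddBelow h

/-- By the spectral theorem, each eigenvalue of the shifted matrix becomes an eigenvalue of `S`
after adding `minEig S`, hence is nonnegative. For an empty index type the infimum takes a default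
value, which is harmless. -/
theorem posSemidef_sub_minEig {S : Matrix m m ℝ} (hS : S.transpose = S) :
    (S - minEig S • (1 : Matrix m m ℝ)).PosSemidef := by
  have hH : (S - minEig S • (1 : Matrix m m ℝ)).IsHermitian := by
    rw [Matrix.IsHermitian, Matrix.conjTranspose_eq_transpose_of_trivial]
    simp [hS]
  rw [hH.posSemidef_iff_eigenvalues_nonneg]
  intro i
  have h := hH.mulVec_eigenvectorBasis i
  have hne : (hH.eigenvectorBasis i).ofLp ≠ 0 := by
    intro h0
    exact hH.eigenvectorBasis.orthonormal.ne_zero i (WithLp.ofLp_injective 2 h0)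
  have : minEig S ≤ hH.eigenvalues i + minEig S := by
    refine minEig_le_of_hasEigenvalue (Module.End.hasEigenvalue_of_hasEigenvector
      (x := (hH.eigenvectorBasis i).ofLp) ⟨?_, hne⟩)
    rw [Module.End.mem_eigenspace_iff, Matrix.toLin'_apply, add_smul, ← h]
    simp [Matrix.sub_mulVec, Matrix.smul_mulVec]
  simpa using this

end Frobenius

/-! ### Rotational block diagonal matrices and the normal space of the manifold -/

section BlockDiag

variable {d n r : ℕ}

/-- Two columns are rotational columns of the same block. -/
def SameRot (c c' : Col d n) : Prop := c.1 = c'.1 ∧ c.2 ≠ Fin.last d ∧ c'.2 ≠ Fin.last d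

theorem SameRot.symm {c c' : Col d n} (h : SameRot c c') : SameRot c' c := ⟨h.1.symm, h.2.2, h.2.1⟩

theorem SameRot.trans {c c' c'' : Col d n} (h : SameRot c c') (h' : SameRot c' c'') :
    SameRot c c'' := ⟨h.1.trans h'.1, h.2.1, h'.2.2⟩

/-- The nonzero entries are in the leading `d × d` parts of the diagonal blocks. -/
def IsRotBlockDiag (N : Matrix (Col d n) (Col d n) ℝ) : Prop :=
  ∀ c c', ¬ SameRot c c' → N c c' = 0

theorem isRotBlockDiag_symBlockDiagPlus (Z : Matrix (Col d n) (Col d n) ℝ) :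
    IsRotBlockDiag (symBlockDiagPlus Z) := fun _ _ h => if_neg h

theorem symBlockDiagPlus_apply {Z : Matrix (Col d n) (Col d n) ℝ} {c c' : Col d n}
    (h : SameRot c c') : symBlockDiagPlus Z c c' = (Z c c' + Z c' c) / 2 := if_pos h

theorem symBlockDiagPlus_transpose (Z : Matrix (Col d n) (Col d n) ℝ) :
    symBlockDiagPlus Z.transpose = symBlockDiagPlus Z := by
  ext c c'
  simp [symBlockDiagPlus, add_comm]

theorem transpose_symBlockDiagPlus (Z : Matrix (Col d n) (Col d n) ℝ) :
    (symBlockDiagPlus Z).transpose = symBlockDiagPlus Z := by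
  ext c c'
  by_cases h : SameRot c c'
  · rw [Matrix.transpose_apply, symBlockDiagPlus_apply h, symBlockDiagPlus_apply h.symm, add_comm]
  · rw [Matrix.transpose_apply, isRotBlockDiag_symBlockDiagPlus _ _ _ h,
      isRotBlockDiag_symBlockDiagPlus _ _ _ fun h' => h h'.symm]

theorem symBlockDiagPlus_sub (Z W : Matrix (Col d n) (Col d n) ℝ) :
    symBlockDiagPlus (Z - W) = symBlockDiagPlus Z - symBlockDiagPlus W := by
  ext c c'
  by_cases h : SameRot c c'
  · simp only [Matrix.sub_apply, symBlockDiagPlus_apply h]; ring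
  · simp only [Matrix.sub_apply, isRotBlockDiag_symBlockDiagPlus _ _ _ h, sub_zero]

theorem symBlockDiagPlus_eq_self {N : Matrix (Col d n) (Col d n) ℝ} (hN : IsRotBlockDiag N)
    (hs : N.transpose = N) : symBlockDiagPlus N = N := by
  ext c c'
  by_cases h : SameRot c c'
  · have : N c' c = N c c' := congrFun (congrFun hs c) c'
    rw [symBlockDiagPlus_apply h, this]; ring
  · rw [isRotBlockDiag_symBlockDiagPlus _ _ _ h, hN _ _ h]

/-- A symmetric `N` pairs equally with `A` and with its transpose, so only the symmetric part of `A`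
on the support of `N` counts. This is the orthogonality of `X * N` to tangent vectors at `X`. -/
theorem frob_eq_zero_of_symBlockDiagPlus {N A : Matrix (Col d n) (Col d n) ℝ}
    (hN : IsRotBlockDiag N) (hs : N.transpose = N) (hA : symBlockDiagPlus A = 0) :
    frob N A = 0 := by
  have h1 : frob N A.transpose = frob N A := by
    conv_lhs => rw [← hs]
    exact frob_transpose N A
  have h2 : frob N A + frob N A.transpose = 2 * frob N (symBlockDiagPlus A) := by
    simp only [frob_eq_sum, ← Finset.sum_add_distrib, Finset.mul_sum]
    refine Finset.sum_congr rfl fun c _ => Finset.sum_congr rfl fun c' _ => ?_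
    by_cases h : SameRot c c'
    · rw [symBlockDiagPlus_apply h, Matrix.transpose_apply]; ring
    · rw [hN _ _ h]; ring
  have h3 : frob N (0 : Matrix (Col d n) (Col d n) ℝ) = 0 := by simp [frob]
  rw [hA, h3] at h2
  linarith

theorem gram_apply_of_mem {X : Factor r d n} (hX : X ∈ manifold r d n) {c c' : Col d n}
    (h : SameRot c c') : (X.transpose * X) c c' = if c = c' then 1 else 0 := by
  obtain ⟨i, a⟩ := c
  obtain ⟨j, b⟩ := c'
  obtain ⟨rfl, ha, hb⟩ : i = j ∧ a ≠ Fin.last d ∧ b ≠ Fin.last d := h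
  obtain ⟨a, rfl⟩ := Fin.exists_castSucc_eq.mpr ha
  obtain ⟨b, rfl⟩ := Fin.exists_castSucc_eq.mpr hb
  have := congrFun (congrFun (hX i) a) b
  rw [Matrix.one_apply] at this
  simpa [Matrix.mul_apply, Factor.rotBlock] using this

/-- Characterization of the SDP constraint by the rotational diagonal blocks. -/
def HasUnitRotBlocks (Z : Matrix (Col d n) (Col d n) ℝ) : Prop :=
  ∀ c c', SameRot c c' → Z c c' = if c = c' then 1 else 0

/-- Row `c` of `N` is supported on the rotational columns of a single block, where `Z` is the
identity. This is how the constraints make `Λ` and the geodesic coefficients blind to the rest of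
`Z`. -/
theorem mul_apply_of_sameRot {N Z : Matrix (Col d n) (Col d n) ℝ} (hN : IsRotBlockDiag N)
    (hZ : HasUnitRotBlocks Z) {c c' : Col d n} (h : SameRot c c') : (N * Z) c c' = N c c' := by
  rw [Matrix.mul_apply]
  have : ∀ e, N c e * Z e c' = if e = c' then N c e else 0 := by
    intro e
    by_cases he : SameRot c e
    · rw [hZ e c' (he.symm.trans h)]; simp
    · rw [hN _ _ he]; simp
  simp [this]

theorem trace_mul_of_isRotBlockDiag {N Z : Matrix (Col d n) (Col d n) ℝ} (hN : IsRotBlockDiag N)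
    (hZ : HasUnitRotBlocks Z) : (N * Z).trace = N.trace := by
  refine Finset.sum_congr rfl fun c _ => ?_
  rw [Matrix.diag_apply, Matrix.diag_apply]
  by_cases h : SameRot c c
  · exact mul_apply_of_sameRot hN hZ h
  · rw [hN _ _ h, Matrix.mul_apply]
    refine Finset.sum_eq_zero fun e _ => ?_
    rw [hN c e fun h' => h (h'.trans h'.symm), zero_mul]

theorem symBlockDiagPlus_mul {N Z : Matrix (Col d n) (Col d n) ℝ} (hN : IsRotBlockDiag N)
    (hs : N.transpose = N) (hZ : HasUnitRotBlocks Z) : symBlockDiagPlus (N * Z) = N := by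
  rw [← symBlockDiagPlus_eq_self hN hs]
  ext c c'
  by_cases h : SameRot c c'
  · rw [symBlockDiagPlus_apply h, symBlockDiagPlus_apply h, symBlockDiagPlus_eq_self hN hs,
      mul_apply_of_sameRot hN hZ h, mul_apply_of_sameRot hN hZ h.symm]
  · rw [isRotBlockDiag_symBlockDiagPlus _ _ _ h, isRotBlockDiag_symBlockDiagPlus _ _ _ h]

/-- A matrix orthogonal to the tangent space at `X` is `X` times a symmetric block diagonal
matrix. -/
theorem eq_mul_of_orthogonal_tangentSpace {X : Factor r d n} (hX : X ∈ manifold r d n)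
    {A : Factor r d n} (hA : ∀ η ∈ tangentSpace X, frob A η = 0) :
    A = X * symBlockDiagPlus (X.transpose * A) := by
  set M := symBlockDiagPlus (X.transpose * A) with hM
  have hMr : IsRotBlockDiag M := isRotBlockDiag_symBlockDiagPlus _
  have hMs : M.transpose = M := transpose_symBlockDiagPlus _
  -- The multiplier `M` is chosen so that `A - X * M` is tangent. The difference is then orthogonal
  -- to `A` by hypothesis and to `X * M` by symmetry of `M`, hence to itself.
  have hη : symBlockDiagPlus ((A - X * M).transpose * X) = 0 := by
    rw [Matrix.transpose_sub, Matrix.sub_mul, symBlockDiagPlus_sub, Matrix.transpose_mul, hMs,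
      Matrix.mul_assoc, symBlockDiagPlus_mul hMr hMs fun _ _ => gram_apply_of_mem hX,
      ← symBlockDiagPlus_transpose, Matrix.transpose_mul, Matrix.transpose_transpose, ← hM,
      sub_self]
  have h1 := hA _ hη
  have h2 : frob (X * M) (A - X * M) = 0 := by
    rw [frob_mul_left]
    refine frob_eq_zero_of_symBlockDiagPlus hMr hMs ?_
    rw [← symBlockDiagPlus_transpose, Matrix.transpose_mul, Matrix.transpose_transpose, hη]
  have h3 : frob (A - X * M) (A - X * M) = 0 := by
    rw [frob_sub_left, h1, h2, sub_zero]
  exact sub_eq_zero.mp (eq_zero_of_frob_self h3)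

end BlockDiag

/-! ### Appending a zero row, and feasibility of Gram matrices -/

section Lift

variable {d n r : ℕ}

@[simp] theorem lift_castSucc (X : Factor r d n) (a : Fin r) : lift X a.castSucc = X a :=
  Fin.snoc_castSucc (α := fun _ => Col d n → ℝ) 0 X a

@[simp] theorem lift_last (X : Factor r d n) : lift X (Fin.last r) = 0 :=
  Fin.snoc_last (α := fun _ => Col d n → ℝ) 0 X

@[simp] theorem lastRow_castSucc (v : Col d n → ℝ) (a : Fin r) :
    lastRow r v a.castSucc = 0 :=
  Fin.snoc_castSucc (α := fun _ => Col d n → ℝ) v 0 a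

@[simp] theorem lastRow_last (v : Col d n → ℝ) : lastRow r v (Fin.last r) = v :=
  Fin.snoc_last (α := fun _ => Col d n → ℝ) v 0

theorem gram_lift (X : Factor r d n) : (lift X).transpose * lift X = X.transpose * X := by
  ext c c'
  simp [Matrix.mul_apply, Fin.sum_univ_castSucc]

end Lift

section Feasible

variable {d n r : ℕ}

theorem mem_sdpFeasible_iff {Z : Matrix (Col d n) (Col d n) ℝ} :
    Z ∈ PoseGraph.sdpFeasible d n ↔ Z.PosSemidef ∧ HasUnitRotBlocks Z := by
  refine and_congr_right fun _ => ⟨fun h c c' hc => ?_, fun h i a b => ?_⟩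
  · obtain ⟨i, a⟩ := c
    obtain ⟨j, b⟩ := c'
    obtain ⟨rfl, ha, hb⟩ : i = j ∧ a ≠ Fin.last d ∧ b ≠ Fin.last d := hc
    obtain ⟨a, rfl⟩ := Fin.exists_castSucc_eq.mpr ha
    obtain ⟨b, rfl⟩ := Fin.exists_castSucc_eq.mpr hb
    rw [h i a b]
    simp
  · have := h (i, a.castSucc) (i, b.castSucc)
      ⟨rfl, Fin.castSucc_ne_last a, Fin.castSucc_ne_last b⟩
    simpa using this

theorem posSemidef_gram (X : Factor r d n) : (X.transpose * X).PosSemidef :=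
  Matrix.posSemidef_conjTranspose_mul_self X

theorem gram_mem_sdpFeasible {X : Factor r d n} (hX : X ∈ manifold r d n) :
    X.transpose * X ∈ PoseGraph.sdpFeasible d n :=
  mem_sdpFeasible_iff.mpr ⟨posSemidef_gram X, fun _ _ => gram_apply_of_mem hX⟩

end Feasible

/-! ### Weak duality through the certificate matrix -/

namespace PoseGraph

variable {d n : ℕ} (G : PoseGraph d n) {r : ℕ}

theorem posSemidef_Q : G.Q.PosSemidef := by
  refine Matrix.posSemidef_sum _ fun e he => ?_
  refine Matrix.PosSemidef.add ?_ ?_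
  · exact (Matrix.posSemidef_self_mul_conjTranspose _).smul (G.wRot_pos _ _ he).le
  · exact (Matrix.posSemidef_vecMulVec_self_star _).smul (G.wTrans_pos _ _ he).le

theorem frob_Q_nonneg {Z : Matrix (Col d n) (Col d n) ℝ} (hZ : Z.PosSemidef) : 0 ≤ frob G.Q Z :=
  frob_nonneg_of_posSemidef G.posSemidef_Q hZ

theorem cost_lift (X : Factor r d n) : G.cost (lift X) = G.cost X := by
  rw [cost, cost, gram_lift]

theorem cert_lift (X : Factor r d n) : G.cert (lift X) = G.cert X := by
  rw [cert, cert, gram_lift]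

theorem cert_isSymm (X : Factor r d n) : (G.cert X).transpose = G.cert X := by
  rw [cert, Matrix.transpose_sub, Q_isSymm, transpose_symBlockDiagPlus]

/-- The stationarity condition of the Lagrangian. -/
theorem mul_cert_of_isCritical {X : Factor r d n} (h : G.IsCritical X) : X * G.cert X = 0 := by
  have h1 : ∀ η ∈ tangentSpace X, frob (X * G.Q) η = 0 := by
    intro η hη
    have := h.2 η hη
    rw [euclGrad, frob_smul_left] at this
    linarith
  have h2 := eq_mul_of_orthogonal_tangentSpace h.1 h1
  rw [cert, Matrix.mul_sub, Matrix.mul_assoc X.transpose, ← h2, sub_self]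

/-- Weak duality at a critical point, up to the least eigenvalue of the certificate matrix. -/
theorem cost_add_minEig_le {X : Factor r d n} (h : G.IsCritical X)
    {Z : Matrix (Col d n) (Col d n) ℝ} (hZ : Z ∈ sdpFeasible d n) :
    G.cost X + minEig (G.cert X) * Z.trace ≤ frob G.Q Z := by
  obtain ⟨hP, hU⟩ := mem_sdpFeasible_iff.mp hZ
  set S := G.cert X with hS
  set Λ := symBlockDiagPlus (X.transpose * X * G.Q) with hΛ
  have hΛr : IsRotBlockDiag Λ := isRotBlockDiag_symBlockDiagPlus _
  have hΛs : Λ.transpose = Λ := transpose_symBlockDiagPlus _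
  have hQ : G.Q = S + Λ := by rw [hS, cert]; abel
  have hSs : S.transpose = S := G.cert_isSymm X
  have h0 : 0 ≤ frob (S - minEig S • 1) Z :=
    frob_nonneg_of_posSemidef (posSemidef_sub_minEig hSs) hP
  have h1 : frob (S - minEig S • 1) Z = (S * Z).trace - minEig S * Z.trace := by
    simp [frob, Matrix.sub_mul, hSs]
  -- Complementary slackness, from stationarity.
  have h2 : (S * (X.transpose * X)).trace = 0 := by
    rw [Matrix.trace_mul_comm, Matrix.mul_assoc, G.mul_cert_of_isCritical h]
    simp
  have h3 : frob G.Q Z = (S * Z).trace + Λ.trace := by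
    rw [← trace_mul_of_isRotBlockDiag hΛr hU, frob, Q_isSymm, hQ, Matrix.add_mul,
      Matrix.trace_add]
  have h4 : G.cost X = Λ.trace := by
    rw [cost, frob, Q_isSymm, hQ, Matrix.add_mul, Matrix.trace_add, h2, zero_add,
      trace_mul_of_isRotBlockDiag hΛr fun _ _ => gram_apply_of_mem h.1]
  linarith

theorem isSDPMinimizer_of_minEig_nonneg {X : Factor r d n} (h : G.IsCritical X)
    (h0 : 0 ≤ minEig (G.cert X)) : G.IsSDPMinimizer (X.transpose * X) := by
  refine ⟨gram_mem_sdpFeasible h.1, fun Z hZ => ?_⟩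
  have := G.cost_add_minEig_le h hZ
  have := mul_nonneg h0 hZ.1.trace_nonneg
  rw [cost] at *
  linarith

theorem bddBelow_sdp : BddBelow ((fun Z => frob G.Q Z) '' sdpFeasible d n) :=
  ⟨0, by rintro _ ⟨Z, hZ, rfl⟩; exact G.frob_Q_nonneg hZ.1⟩

theorem sdpValue_le_cost {X : Factor r d n} (hX : X ∈ manifold r d n) :
    G.sdpValue ≤ G.cost X :=
  csInf_le G.bddBelow_sdp ⟨_, gram_mem_sdpFeasible hX, rfl⟩

/-! ### Rank-independent bounds for the certificate matrix -/

theorem cost_eq_sum (X : Factor r d n) : G.cost X = ∑ a, X a ⬝ᵥ G.Q.mulVec (X a) := by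
  rw [← trace_mul_mul_transpose, cost, frob, Q_isSymm, ← Matrix.mul_assoc, Matrix.trace_mul_comm,
    Matrix.mul_assoc]

/-- Cauchy–Schwarz for the form `Q`, between each row of `X` and a basis vector. The factor enters
only through its cost, so the bound is uniform in the rank. -/
theorem sum_mul_Q_sq_le (X : Factor r d n) (c : Col d n) :
    ∑ a, (X * G.Q) a c ^ 2 ≤ G.cost X * G.Q c c := by
  rw [cost_eq_sum, Finset.sum_mul]
  refine Finset.sum_le_sum fun a _ => ?_
  have h := sq_dotProduct_mulVec_le G.posSemidef_Q (X a) (Pi.single c 1)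
  rw [single_one_dotProduct, Matrix.mulVec_single_one] at h
  simpa [Matrix.mul_apply, dotProduct] using h

theorem gram_mul_Q_sq_le {X : Factor r d n} (hX : X ∈ manifold r d n) {c : Col d n}
    (hc : SameRot c c) (c' : Col d n) :
    ((X.transpose * X * G.Q) c c') ^ 2 ≤ G.cost X * G.Q c' c' := by
  refine le_trans ?_ (G.sum_mul_Q_sq_le X c')
  have h1 : ∑ a, X a c ^ 2 = 1 := by
    have := gram_apply_of_mem hX hc
    simpa [Matrix.mul_apply, sq] using this
  rw [Matrix.mul_assoc, Matrix.mul_apply]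
  refine (Finset.sum_mul_sq_le_sq_mul_sq _ _ _).trans_eq ?_
  simp only [Matrix.transpose_apply]
  rw [h1, one_mul]

/-- The certificate matrices of all ranks are bounded on a sublevel set. -/
theorem bddAbove_frobNorm_cert (fbar : ℝ) :
    BddAbove {s : ℝ | ∃ (r : ℕ) (X : Factor r d n),
      X ∈ manifold r d n ∧ G.cost X ≤ fbar ∧ s = frobNorm (G.cert X)} := by
  -- Entrywise `(q - (x + y) / 2)² ≤ 2 q² + x² + y²`, with `x²` and `y²` bounded by the cost. Only
  -- rotational columns of `X`, of unit norm, enter; the translational ones are unbounded because of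
  -- the translation gauge.
  refine ⟨Real.sqrt (∑ c : Col d n, ∑ c' : Col d n,
    (2 * G.Q c c' ^ 2 + fbar * (G.Q c c + G.Q c' c'))), ?_⟩
  rintro _ ⟨r, X, hX, hf, rfl⟩
  refine Real.sqrt_le_sqrt ?_
  rw [frob_eq_sum]
  refine Finset.sum_le_sum fun c _ => Finset.sum_le_sum fun c' _ => ?_
  have hd : ∀ c, 0 ≤ G.Q c c := fun c => G.posSemidef_Q.diag_nonneg
  have h0 : 0 ≤ G.cost X := G.frob_Q_nonneg (posSemidef_gram X)
  have hm : ∀ c, G.cost X * G.Q c c ≤ fbar * G.Q c c := fun c =>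
    mul_le_mul_of_nonneg_right hf (hd c)
  rw [cert, Matrix.sub_apply]
  by_cases h : SameRot c c'
  · rw [symBlockDiagPlus_apply h]
    have h1 := (G.gram_mul_Q_sq_le hX (h.trans h.symm) c').trans (hm c')
    have h2 := (G.gram_mul_Q_sq_le hX (h.symm.trans h) c).trans (hm c)
    set x := (X.transpose * X * G.Q) c c'
    set y := (X.transpose * X * G.Q) c' c
    nlinarith [sq_nonneg (G.Q c c' + (x + y) / 2), sq_nonneg (x - y)]
  · rw [isRotBlockDiag_symBlockDiagPlus _ _ _ h]
    have := mul_nonneg (h0.trans hf) (add_nonneg (hd c) (hd c'))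
    nlinarith [sq_nonneg (G.Q c c')]

theorem frobNorm_cert_le_cS {X : Factor r d n} (hX : X ∈ manifold r d n) {fbar : ℝ}
    (hf : G.cost X ≤ fbar) : frobNorm (G.cert X) ≤ G.cS fbar :=
  le_csSup (G.bddAbove_frobNorm_cert fbar) ⟨r, X, hX, hf, rfl⟩

/-- Both square roots in `kappa` are at least `1` as soon as `d * n ≥ 1`. This lower bound on
`kappa` is all that the descent estimate requires. -/
theorem four_mul_le_kappa {X : Factor r d n} (hX : X ∈ manifold r d n) {fbar : ℝ}
    (hf : G.cost X ≤ fbar) (hd : 0 < d) (hn : 0 < n) :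
    4 * (frobNorm (G.cert X) + frobNorm G.Q) ≤ G.kappa fbar := by
  have h1 : (1 : ℝ) ≤ d * n := by exact_mod_cast Nat.mul_pos hd hn
  -- For `n = 1` the infimum and the quotient take the default value `0`, which is consistent with
  -- this bound.
  have h2 : 0 ≤ G.cF fbar / G.algConn :=
    div_nonneg (mul_nonneg (Nat.cast_nonneg _) (sq_nonneg _))
      (Real.sInf_nonneg fun x hx => hx.1.le)
  have h3 : 1 ≤ Real.sqrt (d * n + G.cF fbar / G.algConn) := Real.one_le_sqrt.mpr (by linarith)
  have h4 : 1 ≤ Real.sqrt (d * n) := Real.one_le_sqrt.mpr h1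
  have h5 := G.frobNorm_cert_le_cS hX hf
  have h6 := frobNorm_nonneg (G.cert X)
  have h7 := frobNorm_nonneg G.Q
  have h8 := le_mul_of_one_le_right h7 h3
  have h9 := le_mul_of_one_le_right (h6.trans h5) h4
  rw [kappa]
  linarith

end PoseGraph

/-! ### Uniqueness for the linear oscillator -/

section Calculus

theorem eq_of_hasDerivAt_zero {f : ℝ → ℝ} (h : ∀ t, HasDerivAt f 0 t) (t : ℝ) : f t = f 0 :=
  is_const_of_deriv_eq_zero (fun s => (h s).differentiableAt) (fun s => (h s).deriv) t 0

theorem hasDerivAt_transpose_mul {m k : Type*} [Fintype k] {A B : ℝ → Matrix k m ℝ}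
    {A' B' : Matrix k m ℝ} {t : ℝ} (hA : ∀ a c, HasDerivAt (fun s => A s a c) (A' a c) t)
    (hB : ∀ a c, HasDerivAt (fun s => B s a c) (B' a c) t) (c c' : m) :
    HasDerivAt (fun s => ((A s).transpose * B s) c c')
      ((A'.transpose * B t) c c' + ((A t).transpose * B') c c') t := by
  simp only [Matrix.mul_apply, Matrix.transpose_apply, ← Finset.sum_add_distrib]
  exact HasDerivAt.fun_sum fun a _ => (hA a c).mul (hB a c')

/-- Uniqueness for the linear system `k'' = -N k` with positive semidefinite `N`. -/
theorem eq_zero_of_oscillator {m : Type*} [Fintype m] {N : Matrix m m ℝ} (hN : N.PosSemidef)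
    {k k' : ℝ → m → ℝ} (hk : ∀ t c, HasDerivAt (fun s => k s c) (k' t c) t)
    (hk' : ∀ t c, HasDerivAt (fun s => k' s c) (-(N.mulVec (k t) c)) t)
    (h0 : k 0 = 0) (h0' : k' 0 = 0) (t : ℝ) : k t = 0 := by
  have hs : ∀ x y : m → ℝ, y ⬝ᵥ N.mulVec x = x ⬝ᵥ N.mulVec y := by
    intro x y
    have hT : N.transpose = N := hN.isHermitian
    rw [dotProduct_comm, ← Matrix.vecMul_transpose, hT, Matrix.dotProduct_mulVec]
  have hNk : ∀ t c, HasDerivAt (fun s => N.mulVec (k s) c) (N.mulVec (k' t) c) t := by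
    intro t c
    simp only [Matrix.mulVec, dotProduct]
    exact HasDerivAt.fun_sum fun e _ => (hk t e).const_mul (N c e)
  -- The energy `|k'|² + kᵀ N k` is conserved and starts at zero; both terms are nonnegative, so `k'
  -- = 0` and `k` is constant.
  have hE : ∀ t, HasDerivAt (fun s => k' s ⬝ᵥ k' s + k s ⬝ᵥ N.mulVec (k s)) 0 t := by
    intro t
    have h1 : HasDerivAt (fun s => k' s ⬝ᵥ k' s)
        ((fun c => -(N.mulVec (k t) c)) ⬝ᵥ k' t + k' t ⬝ᵥ fun c => -(N.mulVec (k t) c)) t := by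
      simp only [dotProduct, ← Finset.sum_add_distrib]
      exact HasDerivAt.fun_sum fun c _ => (hk' t c).mul (hk' t c)
    have h2 : HasDerivAt (fun s => k s ⬝ᵥ N.mulVec (k s))
        (k' t ⬝ᵥ N.mulVec (k t) + k t ⬝ᵥ N.mulVec (k' t)) t := by
      simp only [dotProduct, ← Finset.sum_add_distrib]
      exact HasDerivAt.fun_sum fun c _ => (hk t c).mul (hNk t c)
    refine (h1.add h2).congr_deriv ?_
    have h3 : (fun c => -(N.mulVec (k t) c)) = -(N.mulVec (k t)) := rfl
    rw [h3, neg_dotProduct, dotProduct_neg, dotProduct_comm (N.mulVec (k t)), hs (k' t) (k t)]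
    rw [hs (k t) (k' t)]
    ring
  have hz : ∀ t, k' t = 0 := by
    intro t
    have h1 := eq_of_hasDerivAt_zero hE t
    simp only [h0, h0', zero_dotProduct, add_zero] at h1
    have h2 : 0 ≤ k t ⬝ᵥ N.mulVec (k t) := by simpa using hN.dotProduct_mulVec_nonneg (k t)
    have h3 := dotProduct_self_nonneg_real (k' t)
    exact dotProduct_self_eq_zero.mp (by linarith)
  funext c
  have h1 : ∀ t, HasDerivAt (fun s => k s c) 0 t := fun t => by
    have := hk t c
    rwa [hz t] at this
  have := eq_of_hasDerivAt_zero h1 t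
  rw [this, h0]

end Calculus

/-! ### The coefficient matrices of the geodesic -/

section RotOuter

variable {d n r : ℕ}

/-- The rotational part of a row vector. -/
def rotPart (v : Col d n → ℝ) : Col d n → ℝ := fun c => if c.2 = Fin.last d then 0 else v c

/-- The translational part of a row vector. -/
def trPart (v : Col d n → ℝ) : Col d n → ℝ := fun c => if c.2 = Fin.last d then v c else 0

theorem rotPart_add_trPart (v : Col d n → ℝ) (c : Col d n) : rotPart v c + trPart v c = v c := by
  unfold rotPart trPart
  split_ifs <;> simp

theorem rotPart_mul_trPart (v : Col d n → ℝ) (c : Col d n) : rotPart v c * trPart v c = 0 := by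
  unfold rotPart trPart
  split_ifs <;> simp

/-- Inner product of the rotational part of `v` with `x` in block `i`. -/
def blockDot (v x : Col d n → ℝ) (i : Fin n) : ℝ := ∑ b, rotPart v (i, b) * x (i, b)

/-- Norm of the rotational part of `v` in block `i`. -/
def rotNorm (v : Col d n → ℝ) (i : Fin n) : ℝ := Real.sqrt (blockDot v (rotPart v) i)

theorem rotNorm_nonneg (v : Col d n → ℝ) (i : Fin n) : 0 ≤ rotNorm v i := Real.sqrt_nonneg _

theorem rotNorm_sq (v : Col d n → ℝ) (i : Fin n) :
    rotNorm v i ^ 2 = blockDot v (rotPart v) i :=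
  Real.sq_sqrt (Finset.sum_nonneg fun _ _ => mul_self_nonneg _)

theorem rotPart_eq_zero {v : Col d n → ℝ} {c : Col d n} (h : rotNorm v c.1 = 0) :
    rotPart v c = 0 := by
  have h1 := rotNorm_sq v c.1
  rw [h, blockDot, eq_comm] at h1
  rw [show (0 : ℝ) ^ 2 = 0 by norm_num,
    Finset.sum_eq_zero_iff_of_nonneg fun _ _ => mul_self_nonneg _] at h1
  exact mul_self_eq_zero.mp (h1 c.2 (Finset.mem_univ _))

/-- The block diagonal matrix with blocks `φ i • vᵢ vᵢᵀ`, where `vᵢ` is the rotational part of `v`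
in block `i`. -/
def rotOuter (φ : Fin n → ℝ) (v : Col d n → ℝ) : Matrix (Col d n) (Col d n) ℝ :=
  Matrix.of fun c c' => if c.1 = c'.1 then φ c.1 * (rotPart v c * rotPart v c') else 0

theorem rotOuter_transpose (φ : Fin n → ℝ) (v : Col d n → ℝ) :
    (rotOuter φ v).transpose = rotOuter φ v := by
  ext c c'
  by_cases h : c.1 = c'.1
  · simp [rotOuter, h, mul_comm]
  · simp [rotOuter, h, Ne.symm h]

theorem isRotBlockDiag_rotOuter (φ : Fin n → ℝ) (v : Col d n → ℝ) :
    IsRotBlockDiag (rotOuter φ v) := by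
  intro c c' h
  by_cases h1 : c.1 = c'.1
  · by_cases h2 : c.2 = Fin.last d
    · simp [rotOuter, rotPart, h2]
    · have h3 : c'.2 = Fin.last d := by
        by_contra h3
        exact h ⟨h1, h2, h3⟩
      simp [rotOuter, rotPart, h3]
  · simp [rotOuter, h1]

theorem sum_col_ite (f : Col d n → ℝ) (i : Fin n) :
    ∑ c : Col d n, (if i = c.1 then f c else 0) = ∑ b, f (i, b) := by
  rw [Fintype.sum_prod_type, Finset.sum_eq_single i]
  · simp
  · intro j _ hj
    simp [Ne.symm hj]
  · simp

theorem rotOuter_mulVec (φ : Fin n → ℝ) (v x : Col d n → ℝ) (c : Col d n) :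
    (rotOuter φ v).mulVec x c = φ c.1 * blockDot v x c.1 * rotPart v c := by
  have : ∀ e, rotOuter φ v c e * x e =
      if c.1 = e.1 then φ c.1 * rotPart v c * (rotPart v e * x e) else 0 := by
    intro e
    simp only [rotOuter, Matrix.of_apply]
    split_ifs <;> ring
  simp only [Matrix.mulVec, dotProduct, this]
  rw [sum_col_ite (fun e => φ c.1 * rotPart v c * (rotPart v e * x e)), ← Finset.mul_sum, blockDot]
  ring

theorem dotProduct_rotOuter (φ : Fin n → ℝ) (v x : Col d n → ℝ) :
    x ⬝ᵥ (rotOuter φ v).mulVec x = ∑ i, φ i * blockDot v x i ^ 2 := by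
  simp only [dotProduct, rotOuter_mulVec]
  rw [Fintype.sum_prod_type]
  refine Finset.sum_congr rfl fun i _ => ?_
  have h : φ i * blockDot v x i ^ 2 =
      ∑ b, φ i * blockDot v x i * (rotPart v (i, b) * x (i, b)) := by
    rw [← Finset.mul_sum]
    change _ = φ i * blockDot v x i * blockDot v x i
    ring
  rw [h]
  exact Finset.sum_congr rfl fun b _ => by ring

theorem posSemidef_rotOuter {φ : Fin n → ℝ} (hφ : ∀ i, 0 ≤ φ i) (v : Col d n → ℝ) :
    (rotOuter φ v).PosSemidef :=
  posSemidef_of_dotProduct (rotOuter_transpose φ v) fun x => by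
    rw [dotProduct_rotOuter]
    exact Finset.sum_nonneg fun i _ => mul_nonneg (hφ i) (sq_nonneg _)

end RotOuter

/-! ### Closed form of the escape geodesic -/

section Geodesic

variable {d n r : ℕ}

/-- The geodesic equation for a velocity orthogonal to the column space has constant
coefficients. -/
theorem geodesic_acc {X : Factor r d n} {v : Col d n → ℝ}
    {γ vel acc : ℝ → Factor (r + 1) d n} (hm : ∀ t, γ t ∈ manifold (r + 1) d n)
    (hγ : ∀ t a c, HasDerivAt (fun s => γ s a c) (vel t a c) t)
    (hv : ∀ t a c, HasDerivAt (fun s => vel s a c) (acc t a c) t)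
    (ho : ∀ t, ∀ η ∈ tangentSpace (γ t), frob (acc t) η = 0)
    (h0 : γ 0 = lift X) (h0' : vel 0 = lastRow r v) (t : ℝ) :
    acc t = -(γ t * rotOuter 1 v) := by
  set M : ℝ → Matrix (Col d n) (Col d n) ℝ :=
    fun t => symBlockDiagPlus ((γ t).transpose * acc t) with hM
  have hMr : ∀ t, IsRotBlockDiag (M t) := fun t => isRotBlockDiag_symBlockDiagPlus _
  have hMs : ∀ t, (M t).transpose = M t := fun t => transpose_symBlockDiagPlus _
  have hacc : ∀ t, acc t = γ t * M t := fun t => eq_mul_of_orthogonal_tangentSpace (hm t) (ho t)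
  have hswap : ∀ (A B : Factor (r + 1) d n) (c c' : Col d n),
      (A.transpose * B) c c' = (B.transpose * A) c' c := by
    intro A B c c'
    simp only [Matrix.mul_apply, Matrix.transpose_apply, mul_comm]
  have e1 : ∀ t c c', SameRot c c' →
      ((vel t).transpose * γ t) c c' + ((γ t).transpose * vel t) c c' = 0 := by
    intro t c c' h
    refine (hasDerivAt_transpose_mul (hγ t) (hγ t) c c').unique ?_
    have : (fun s => ((γ s).transpose * γ s) c c') = fun _ => if c = c' then 1 else 0 :=
      funext fun s => gram_apply_of_mem (hm s) h
    rw [this]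
    exact hasDerivAt_const _ _
  -- Differentiating the constraint twice determines the multiplier.
  have e2 : ∀ t c c', SameRot c c' → M t c c' = -((vel t).transpose * vel t) c c' := by
    intro t c c' h
    have h1 := (hasDerivAt_transpose_mul (hv t) (hγ t) c c').add
      (hasDerivAt_transpose_mul (hγ t) (hv t) c c')
    have h2 : ((fun s => ((vel s).transpose * γ s) c c') +
        fun s => ((γ s).transpose * vel s) c c') = fun _ => 0 :=
      funext fun s => e1 s c c' h
    rw [h2] at h1
    have h3 := h1.unique (hasDerivAt_const t (0 : ℝ))
    rw [hM]
    simp only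
    rw [symBlockDiagPlus_apply h, hswap (γ t) (acc t) c' c]
    linarith
  -- The derivative of `γᵀ γ'` on a block is `γ'ᵀ γ' + M = 0`. Its initial value vanishes because
  -- `lift X` and `lastRow r v` have no common nonzero row.
  have e3 : ∀ t c c', SameRot c c' → ((γ t).transpose * vel t) c c' = 0 := by
    intro t c c' h
    have hd : ∀ t, HasDerivAt (fun s => ((γ s).transpose * vel s) c c') 0 t := by
      intro t
      refine (hasDerivAt_transpose_mul (hγ t) (hv t) c c').congr_deriv ?_
      have h1 : ((γ t).transpose * acc t) c c' = M t c c' := by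
        rw [hswap, hacc, Matrix.transpose_mul, hMs, Matrix.mul_assoc,
          mul_apply_of_sameRot (hMr t) (fun _ _ => gram_apply_of_mem (hm t)) h.symm]
        exact congrFun (congrFun (hMs t) c) c'
      rw [h1, e2 t c c' h]
      ring
    rw [eq_of_hasDerivAt_zero hd t, h0, h0']
    simp [Matrix.mul_apply, Fin.sum_univ_castSucc]
  have e4 : ∀ t c c', SameRot c c' → ((acc t).transpose * vel t) c c' = 0 := by
    intro t c c' h
    rw [hacc, Matrix.transpose_mul, hMs, Matrix.mul_assoc, Matrix.mul_apply]
    refine Finset.sum_eq_zero fun e _ => ?_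
    by_cases he : SameRot c e
    · rw [e3 t e c' (he.symm.trans h), mul_zero]
    · rw [hMr t _ _ he, zero_mul]
  -- By `e4` the block Gram matrices of the velocity are conserved. With `e2` this makes the
  -- multiplier constant in time.
  have e5 : ∀ t c c', SameRot c c' → ((vel t).transpose * vel t) c c' = v c * v c' := by
    intro t c c' h
    have hd : ∀ t, HasDerivAt (fun s => ((vel s).transpose * vel s) c c') 0 t := by
      intro t
      refine (hasDerivAt_transpose_mul (hv t) (hv t) c c').congr_deriv ?_
      rw [hswap (vel t) (acc t), e4 t c c' h, e4 t c' c h.symm, add_zero]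
    rw [eq_of_hasDerivAt_zero hd t, h0']
    simp [Matrix.mul_apply, Fin.sum_univ_castSucc]
  have e6 : M t = -rotOuter 1 v := by
    ext c c'
    by_cases h : SameRot c c'
    · rw [e2 t c c' h, e5 t c c' h]
      simp [rotOuter, h.1, rotPart, h.2.1, h.2.2]
    · rw [hMr t _ _ h, Matrix.neg_apply, isRotBlockDiag_rotOuter _ _ _ _ h, neg_zero]
  rw [hacc, e6, Matrix.mul_neg]

/-- The rotational displacement coefficients along the geodesic. -/
def cosCoeff (v : Col d n → ℝ) (t : ℝ) (i : Fin n) : ℝ :=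
  (1 - Real.cos (rotNorm v i * t)) / rotNorm v i ^ 2

/-- The last row of the geodesic. -/
def geoRow (v : Col d n → ℝ) (t : ℝ) : Col d n → ℝ := fun c =>
  Real.sin (rotNorm v c.1 * t) / rotNorm v c.1 * rotPart v c + t * trPart v c

/-- In block `i` the coefficient matrix has eigenvalue `νᵢ²` on the line of `vᵢ` and `0` on its
complement, so the component along `vᵢ` is multiplied by `cos (νᵢ t)` and the rest stays fixed. The
difference from this formula solves the oscillator with zero initial data. If `νᵢ = 0`, then `vᵢ =
0`, and the default value of the quotient does no harm. -/
theorem geodesic_castSucc {v x : Col d n → ℝ} {k k' : ℝ → Col d n → ℝ}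
    (hk : ∀ t c, HasDerivAt (fun s => k s c) (k' t c) t)
    (hk' : ∀ t c, HasDerivAt (fun s => k' s c) (-((rotOuter 1 v).mulVec (k t) c)) t)
    (h0 : k 0 = x) (h0' : k' 0 = 0) (t : ℝ) :
    k t = x - (rotOuter (cosCoeff v t) v).mulVec x := by
  set ν := rotNorm v
  have hd1 : ∀ t c, HasDerivAt (fun s => (k s - (x - (rotOuter (cosCoeff v s) v).mulVec x)) c)
      ((k' t + fun c => Real.sin (ν c.1 * t) / ν c.1 * blockDot v x c.1 * rotPart v c) c) t := by
    intro t c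
    simp only [Pi.sub_apply, Pi.add_apply, rotOuter_mulVec, cosCoeff]
    have h1 : HasDerivAt (fun s => Real.cos (ν c.1 * s)) (-Real.sin (ν c.1 * t) * ν c.1) t := by
      simpa using ((hasDerivAt_id t).const_mul (ν c.1)).cos
    have h2 := (((h1.const_sub 1).div_const (ν c.1 ^ 2)).mul_const
      (blockDot v x c.1)).mul_const (rotPart v c)
    refine ((hk t c).sub (h2.const_sub (x c))).congr_deriv ?_
    by_cases hν : ν c.1 = 0
    · simp [hν]
    · field_simp
      ring
  have hd2 : ∀ t c, HasDerivAt
      (fun s => (k' s + fun c => Real.sin (ν c.1 * s) / ν c.1 * blockDot v x c.1 * rotPart v c) c)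
      (-((rotOuter 1 v).mulVec (k t - (x - (rotOuter (cosCoeff v t) v).mulVec x)) c)) t := by
    intro t c
    have h1 : HasDerivAt (fun s => Real.sin (ν c.1 * s)) (Real.cos (ν c.1 * t) * ν c.1) t := by
      simpa using ((hasDerivAt_id t).const_mul (ν c.1)).sin
    have h2 := ((h1.div_const (ν c.1)).mul_const (blockDot v x c.1)).mul_const (rotPart v c)
    refine ((hk' t c).add h2).congr_deriv ?_
    have h3 : blockDot v ((rotOuter (cosCoeff v t) v).mulVec x) c.1 =
        cosCoeff v t c.1 * blockDot v x c.1 * ν c.1 ^ 2 := by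
      rw [rotNorm_sq]
      change ∑ b, rotPart v (c.1, b) * _ = _ * ∑ b, rotPart v (c.1, b) * rotPart v (c.1, b)
      rw [Finset.mul_sum]
      refine Finset.sum_congr rfl fun b _ => ?_
      rw [rotOuter_mulVec]
      ring
    rw [Matrix.mulVec_sub, Matrix.mulVec_sub, Pi.sub_apply, Pi.sub_apply, rotOuter_mulVec _ _ x,
      rotOuter_mulVec _ _ (Matrix.mulVec _ _), h3, cosCoeff]
    by_cases hν : ν c.1 = 0
    · have : rotPart v c = 0 := rotPart_eq_zero hν
      simp [this]
    · have hν' : rotNorm v c.1 ≠ 0 := hν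
      simp only [Pi.one_apply]
      change _ = -((rotOuter 1 v).mulVec (k t) c - (1 * blockDot v x c.1 * rotPart v c -
        1 * ((1 - Real.cos (ν c.1 * t)) / ν c.1 ^ 2 * blockDot v x c.1 * ν c.1 ^ 2) *
          rotPart v c))
      field_simp
      ring
  have h := eq_zero_of_oscillator (posSemidef_rotOuter (fun _ => zero_le_one) v) hd1 hd2
    (by ext c; simp [h0, rotOuter_mulVec, cosCoeff]) (by ext c; simp [h0']) t
  exact sub_eq_zero.mp h

/-- The same uniqueness argument with initial position `0` and velocity `v`: the rotational part
oscillates as `sin (νᵢ t) / νᵢ`, the translational part moves uniformly. -/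
theorem geodesic_last {v : Col d n → ℝ} {k k' : ℝ → Col d n → ℝ}
    (hk : ∀ t c, HasDerivAt (fun s => k s c) (k' t c) t)
    (hk' : ∀ t c, HasDerivAt (fun s => k' s c) (-((rotOuter 1 v).mulVec (k t) c)) t)
    (h0 : k 0 = 0) (h0' : k' 0 = v) (t : ℝ) : k t = geoRow v t := by
  set ν := rotNorm v
  have hd1 : ∀ t c, HasDerivAt (fun s => (k s - geoRow v s) c)
      ((k' t - fun c => Real.cos (ν c.1 * t) * rotPart v c + trPart v c) c) t := by
    intro t c
    have h1 : HasDerivAt (fun s => Real.sin (ν c.1 * s)) (Real.cos (ν c.1 * t) * ν c.1) t := by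
      simpa using ((hasDerivAt_id t).const_mul (ν c.1)).sin
    have h2 := ((h1.div_const (ν c.1)).mul_const (rotPart v c)).add
      ((hasDerivAt_id t).mul_const (trPart v c))
    refine ((hk t c).sub h2).congr_deriv ?_
    by_cases hν : ν c.1 = 0
    · have : rotPart v c = 0 := rotPart_eq_zero hν
      simp [this]
    · simp only [Pi.sub_apply]
      field_simp
  have hd2 : ∀ t c, HasDerivAt
      (fun s => (k' s - fun c => Real.cos (ν c.1 * s) * rotPart v c + trPart v c) c)
      (-((rotOuter 1 v).mulVec (k t - geoRow v t) c)) t := by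
    intro t c
    have h1 : HasDerivAt (fun s => Real.cos (ν c.1 * s)) (-Real.sin (ν c.1 * t) * ν c.1) t := by
      simpa using ((hasDerivAt_id t).const_mul (ν c.1)).cos
    have h2 := (h1.mul_const (rotPart v c)).add_const (trPart v c)
    refine ((hk' t c).sub h2).congr_deriv ?_
    have h3 : blockDot v (geoRow v t) c.1 = Real.sin (ν c.1 * t) / ν c.1 * ν c.1 ^ 2 := by
      rw [rotNorm_sq, blockDot, blockDot, Finset.mul_sum]
      refine Finset.sum_congr rfl fun b _ => ?_
      simp only [geoRow]
      have := rotPart_mul_trPart v (c.1, b)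
      linear_combination t * this
    rw [Matrix.mulVec_sub, Pi.sub_apply, rotOuter_mulVec _ _ (geoRow v t), h3]
    by_cases hν : ν c.1 = 0
    · simp [hν]
    · simp only [Pi.one_apply]
      field_simp
      ring
  have h := eq_zero_of_oscillator (posSemidef_rotOuter (fun _ => zero_le_one) v) hd1 hd2
    (by ext c; simp [h0, geoRow]) (by ext c; simp [h0', rotPart_add_trPart]) t
  exact sub_eq_zero.mp h

/-- The Gram matrix along the geodesic. -/
theorem IsGeodesicFrom.gram_eq {X : Factor r d n} {v : Col d n → ℝ}
    {γ : ℝ → Factor (r + 1) d n} (h : IsGeodesicFrom (lift X) (lastRow r v) γ) (t : ℝ) :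
    (γ t).transpose * γ t =
      (1 - rotOuter (cosCoeff v t) v) * (X.transpose * X) * (1 - rotOuter (cosCoeff v t) v) +
        Matrix.vecMulVec (geoRow v t) (geoRow v t) := by
  obtain ⟨vel, acc, hm, hγ, hv, ho, h0, h0'⟩ := h
  have hacc : ∀ t a c, HasDerivAt (fun s => vel s a c) (-((rotOuter 1 v).mulVec (γ t a) c)) t := by
    intro t a c
    refine (hv t a c).congr_deriv ?_
    rw [geodesic_acc hm hγ hv ho h0 h0' t, Matrix.neg_apply, Matrix.mul_apply]
    congr 1
    refine Finset.sum_congr rfl fun e _ => ?_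
    rw [mul_comm]
    congr 1
    exact congrFun (congrFun (rotOuter_transpose 1 v) c) e
  have hrow : ∀ a : Fin r, γ t a.castSucc =
      (X * (1 - rotOuter (cosCoeff v t) v) : Matrix (Fin r) (Col d n) ℝ) a := by
    intro a
    rw [geodesic_castSucc (x := X a) (fun t => hγ t a.castSucc) (fun t => hacc t a.castSucc)
      (by rw [h0, lift_castSucc]) (by rw [h0', lastRow_castSucc]) t]
    rw [Matrix.mul_sub, Matrix.mul_one]
    ext c
    simp only [Pi.sub_apply, Matrix.sub_apply, Matrix.mulVec, dotProduct, Matrix.mul_apply]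
    congr 1
    refine Finset.sum_congr rfl fun e _ => ?_
    rw [mul_comm]
    congr 1
    exact congrFun (congrFun (rotOuter_transpose (cosCoeff v t) v) e) c
  have hlast : γ t (Fin.last r) = geoRow v t :=
    geodesic_last (fun t => hγ t (Fin.last r)) (fun t => hacc t (Fin.last r))
      (by rw [h0, lift_last]) (by rw [h0', lastRow_last]) t
  have hX : (1 - rotOuter (cosCoeff v t) v) * (X.transpose * X) *
      (1 - rotOuter (cosCoeff v t) v) =
      (X * (1 - rotOuter (cosCoeff v t) v)).transpose * (X * (1 - rotOuter (cosCoeff v t) v)) := by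
    rw [Matrix.transpose_mul, Matrix.transpose_sub, Matrix.transpose_one, rotOuter_transpose]
    simp only [Matrix.mul_assoc]
  rw [hX]
  ext c c'
  rw [Matrix.add_apply, Matrix.mul_apply, Fin.sum_univ_castSucc, Matrix.mul_apply]
  simp only [Matrix.transpose_apply, hrow, hlast, Matrix.vecMulVec_apply]

end Geodesic

/-! ### Algebra and Taylor bounds for the geodesic coefficients -/

section RotOuterAlgebra

variable {d n : ℕ}

theorem IsRotBlockDiag.mul {N M : Matrix (Col d n) (Col d n) ℝ} (hN : IsRotBlockDiag N)
    (hM : IsRotBlockDiag M) : IsRotBlockDiag (N * M) := by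
  intro c c' h
  rw [Matrix.mul_apply]
  refine Finset.sum_eq_zero fun e _ => ?_
  by_cases he : SameRot c e
  · rw [hM e c' fun h' => h (he.trans h'), mul_zero]
  · rw [hN c e he, zero_mul]

theorem rotOuter_mul (φ ψ : Fin n → ℝ) (v : Col d n → ℝ) :
    rotOuter φ v * rotOuter ψ v = rotOuter (fun i => φ i * ψ i * rotNorm v i ^ 2) v := by
  ext c c'
  have h := rotOuter_mulVec φ v (fun e => rotOuter ψ v e c') c
  refine h.trans ?_
  by_cases hc : c.1 = c'.1
  · have hb : blockDot v (fun e => rotOuter ψ v e c') c.1 =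
        ψ c.1 * rotNorm v c.1 ^ 2 * rotPart v c' := by
      rw [rotNorm_sq]
      simp only [blockDot]
      rw [Finset.mul_sum, Finset.sum_mul]
      refine Finset.sum_congr rfl fun b _ => ?_
      simp only [rotOuter, Matrix.of_apply, if_pos hc]
      ring
    rw [hb]
    simp only [rotOuter, Matrix.of_apply, if_pos hc]
    ring
  · have hb : blockDot v (fun e => rotOuter ψ v e c') c.1 = 0 := by
      simp only [blockDot]
      refine Finset.sum_eq_zero fun b _ => ?_
      simp only [rotOuter, Matrix.of_apply, if_neg hc, mul_zero]
    rw [hb]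
    simp only [rotOuter, Matrix.of_apply, if_neg hc]
    ring

theorem sum_rotPart (φ : Fin n → ℝ) (v : Col d n → ℝ) :
    ∑ c : Col d n, φ c.1 * (rotPart v c * rotPart v c) = ∑ i, φ i * rotNorm v i ^ 2 := by
  rw [Fintype.sum_prod_type]
  refine Finset.sum_congr rfl fun i _ => ?_
  rw [rotNorm_sq, blockDot, Finset.mul_sum]

theorem trace_rotOuter (φ : Fin n → ℝ) (v : Col d n → ℝ) :
    (rotOuter φ v).trace = ∑ i, φ i * rotNorm v i ^ 2 := by
  rw [← sum_rotPart]
  refine Finset.sum_congr rfl fun c _ => ?_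
  simp [rotOuter]

theorem sum_rotNorm_sq_le (v : Col d n → ℝ) : ∑ i, rotNorm v i ^ 2 ≤ v ⬝ᵥ v := by
  have := sum_rotPart (fun _ => 1) v
  simp only [one_mul] at this
  rw [← this]
  refine Finset.sum_le_sum fun c _ => ?_
  unfold rotPart
  split_ifs
  · simpa using mul_self_nonneg (v c)
  · exact le_rfl

theorem rotNorm_le_one {v : Col d n → ℝ} (hv : v ⬝ᵥ v = 1) (i : Fin n) : rotNorm v i ≤ 1 := by
  have h := Finset.single_le_sum (f := fun i => rotNorm v i ^ 2) (fun i _ => sq_nonneg _)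
    (Finset.mem_univ i)
  have h2 := (h.trans (sum_rotNorm_sq_le v)).trans_eq hv
  exact (sq_le_one_iff₀ (rotNorm_nonneg v i)).mp h2

theorem sum_mul_rotNorm_sq_le {v : Col d n → ℝ} (hv : v ⬝ᵥ v = 1) {f : Fin n → ℝ} {b : ℝ}
    (hb : 0 ≤ b) (h : ∀ i, f i ≤ b * rotNorm v i ^ 2) : ∑ i, f i ≤ b := by
  refine (Finset.sum_le_sum fun i _ => h i).trans ?_
  rw [← Finset.mul_sum]
  have := mul_le_mul_of_nonneg_left ((sum_rotNorm_sq_le v).trans_eq hv) hb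
  linarith

/-- From `1 - cos x ≤ x² / 2` the coefficients are at most `t² / 2`, and the trace is the sum of
their squares times `νᵢ⁴`, where `∑ νᵢ² ≤ 1`. -/
theorem trace_sq_cosCoeff_le {v : Col d n → ℝ} (hv : v ⬝ᵥ v = 1) (t : ℝ) :
    (rotOuter (cosCoeff v t) v * rotOuter (cosCoeff v t) v).trace ≤ t ^ 4 / 4 := by
  rw [rotOuter_mul, trace_rotOuter]
  refine sum_mul_rotNorm_sq_le hv (by positivity) fun i => ?_
  refine mul_le_mul_of_nonneg_right ?_ (sq_nonneg _)
  have h1 := rotNorm_le_one hv i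
  have h0 := rotNorm_nonneg v i
  have hcos := Real.one_sub_sq_div_two_le_cos (x := rotNorm v i * t)
  have hcos' := Real.cos_le_one (rotNorm v i * t)
  rw [cosCoeff]
  set ν := rotNorm v i
  by_cases hν : ν = 0
  · rw [hν]
    simp only [zero_mul, ne_eq, OfNat.ofNat_ne_zero, not_false_eq_true, zero_pow, mul_zero]
    positivity
  · have h2 : (1 - Real.cos (ν * t)) / ν ^ 2 * ((1 - Real.cos (ν * t)) / ν ^ 2) * ν ^ 2 =
        (1 - Real.cos (ν * t)) ^ 2 / ν ^ 2 := by field_simp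
    rw [h2, div_le_iff₀ (by positivity)]
    have h3 : (1 - Real.cos (ν * t)) ^ 2 ≤ ((ν * t) ^ 2 / 2) ^ 2 :=
      pow_le_pow_left₀ (by linarith) (by linarith) 2
    have h4 : ν ^ 2 ≤ 1 := pow_le_one₀ h0 h1
    have h5 : ν ^ 2 * (ν ^ 2 * t ^ 4) ≤ 1 * (ν ^ 2 * t ^ 4) :=
      mul_le_mul_of_nonneg_right h4 (by positivity)
    nlinarith

/-- Deviation of the last row of the geodesic from the straight line. -/
def geoDev (v : Col d n → ℝ) (t : ℝ) : Col d n → ℝ := fun c =>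
  (t - Real.sin (rotNorm v c.1 * t) / rotNorm v c.1) * rotPart v c

theorem geoRow_eq (v : Col d n → ℝ) (t : ℝ) : geoRow v t = t • v - geoDev v t := by
  ext c
  simp only [geoRow, geoDev, Pi.sub_apply, Pi.smul_apply, smul_eq_mul]
  rw [← rotPart_add_trPart v c]
  ring

/-- The cubic Taylor bound for the sine gives `ν² t³ / 6`, and `ν ≤ 1` removes the dependence on the
block. -/
theorem geoDev_coeff_bounds {ν t : ℝ} (h0 : 0 < ν) (h1 : ν ≤ 1) (ht : 0 ≤ t) :
    0 ≤ t - Real.sin (ν * t) / ν ∧ t - Real.sin (ν * t) / ν ≤ t ^ 3 / 6 := by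
  have e : t - Real.sin (ν * t) / ν = (ν * t - Real.sin (ν * t)) / ν := by field_simp
  have hx : 0 ≤ ν * t := by positivity
  rw [e]
  refine ⟨div_nonneg (by linarith [Real.sin_le hx]) h0.le, ?_⟩
  rw [div_le_iff₀ h0]
  have h2 := (le_abs_self _).trans (Real.abs_sub_sin_le (ν * t))
  rw [abs_of_nonneg hx] at h2
  have h3 : ν ^ 2 ≤ 1 := pow_le_one₀ h0.le h1
  have h4 : ν ^ 2 * (ν * t ^ 3) ≤ 1 * (ν * t ^ 3) := mul_le_mul_of_nonneg_right h3 (by positivity)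
  nlinarith

theorem dotProduct_geoDev_le {v : Col d n → ℝ} (hv : v ⬝ᵥ v = 1) {t : ℝ} (ht : 0 ≤ t) :
    v ⬝ᵥ geoDev v t ≤ t ^ 3 / 6 := by
  have h : v ⬝ᵥ geoDev v t =
      ∑ i, (t - Real.sin (rotNorm v i * t) / rotNorm v i) * rotNorm v i ^ 2 := by
    rw [← sum_rotPart]
    refine Finset.sum_congr rfl fun c _ => ?_
    rw [geoDev, ← rotPart_add_trPart v c]
    linear_combination (t - Real.sin (rotNorm v c.1 * t) / rotNorm v c.1) *
      rotPart_mul_trPart v c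
  rw [h]
  refine sum_mul_rotNorm_sq_le hv (by positivity) fun i => ?_
  rcases (rotNorm_nonneg v i).eq_or_lt with h0 | h0
  · simp [← h0]
  · exact mul_le_mul_of_nonneg_right (geoDev_coeff_bounds h0 (rotNorm_le_one hv i) ht).2
      (sq_nonneg _)

theorem geoDev_dotProduct_self_le {v : Col d n → ℝ} (hv : v ⬝ᵥ v = 1) {t : ℝ} (ht : 0 ≤ t) :
    geoDev v t ⬝ᵥ geoDev v t ≤ t ^ 6 / 36 := by
  have h : geoDev v t ⬝ᵥ geoDev v t =
      ∑ i, (t - Real.sin (rotNorm v i * t) / rotNorm v i) ^ 2 * rotNorm v i ^ 2 := by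
    rw [← sum_rotPart (fun i => (t - Real.sin (rotNorm v i * t) / rotNorm v i) ^ 2)]
    refine Finset.sum_congr rfl fun c _ => ?_
    rw [geoDev]
    ring
  rw [h]
  refine sum_mul_rotNorm_sq_le hv (by positivity) fun i => ?_
  rcases (rotNorm_nonneg v i).eq_or_lt with h0 | h0
  · simp [← h0]
  · refine mul_le_mul_of_nonneg_right ?_ (sq_nonneg _)
    obtain ⟨h1, h2⟩ := geoDev_coeff_bounds h0 (rotNorm_le_one hv i) ht
    calc _ ≤ (t ^ 3 / 6) ^ 2 := pow_le_pow_left₀ h1 h2 2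
      _ = _ := by ring

/-- On the support of rotational block diagonal matrices, the curvature terms of the geodesic
agree to second order. -/
theorem geoRow_dotProduct_mulVec {Λ : Matrix (Col d n) (Col d n) ℝ} (hΛ : IsRotBlockDiag Λ)
    (v : Col d n → ℝ) (t : ℝ) :
    geoRow v t ⬝ᵥ Λ.mulVec (geoRow v t) = 2 * (Λ * rotOuter (cosCoeff v t) v).trace -
      (Λ * (rotOuter (cosCoeff v t) v * rotOuter (cosCoeff v t) v)).trace := by
  rw [rotOuter_mul]
  simp only [Matrix.trace, Matrix.diag, Matrix.mul_apply, dotProduct, Matrix.mulVec,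
    Finset.mul_sum, ← Finset.sum_sub_distrib]
  refine Finset.sum_congr rfl fun c _ => Finset.sum_congr rfl fun c' _ => ?_
  by_cases h : SameRot c c'
  · have h1 : trPart v c = 0 := if_neg h.2.1
    have h2 : trPart v c' = 0 := if_neg h.2.2
    simp only [geoRow, h1, h2, rotOuter, Matrix.of_apply, h.1, if_true, cosCoeff]
    set ν := rotNorm v c'.1
    by_cases hν : ν = 0
    · simp [hν]
    · have hs := Real.sin_sq_add_cos_sq (ν * t)
      field_simp
      linear_combination Λ c c' * rotPart v c * rotPart v c' * hs
  · rw [hΛ _ _ h]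
    ring

end RotOuterAlgebra

/-! ### Decrease of the objective along the escape geodesic -/

namespace PoseGraph

variable {d n : ℕ} (G : PoseGraph d n) {r : ℕ}

/-- Exact change of the objective along the geodesic that leaves a lifted critical point. -/
theorem cost_geodesic_eq {X : Factor r d n} (hX : G.IsCritical X) {v : Col d n → ℝ}
    {γ : ℝ → Factor (r + 1) d n} (h : IsGeodesicFrom (lift X) (lastRow r v) γ) (t : ℝ) :
    G.cost (γ t) = G.cost X + geoRow v t ⬝ᵥ (G.cert X).mulVec (geoRow v t) +
      (rotOuter (cosCoeff v t) v * (G.cert X - G.Q) * (rotOuter (cosCoeff v t) v).transpose).trace +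
      (X * rotOuter (cosCoeff v t) v * G.Q * (X * rotOuter (cosCoeff v t) v).transpose).trace := by
  set C := rotOuter (cosCoeff v t) v with hC
  set w := geoRow v t with hw
  set S := G.cert X with hS
  set Λ := symBlockDiagPlus (X.transpose * X * G.Q) with hΛ
  set Z : Matrix (Col d n) (Col d n) ℝ := X.transpose * X with hZ
  have hΛr : IsRotBlockDiag Λ := isRotBlockDiag_symBlockDiagPlus _
  have hCr : IsRotBlockDiag C := isRotBlockDiag_rotOuter _ _
  have hCs : C.transpose = C := rotOuter_transpose _ _
  have hQ : G.Q = S + Λ := by rw [hS, cert]; abel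
  have hSΛ : S - G.Q = -Λ := by rw [hQ]; abel
  have hU : HasUnitRotBlocks Z := fun _ _ => gram_apply_of_mem hX.1
  have hZS : Z * S = 0 := by rw [hZ, Matrix.mul_assoc, G.mul_cert_of_isCritical hX, Matrix.mul_zero]
  have hSZ : S * Z = 0 := by
    have := congrArg Matrix.transpose hZS
    rwa [Matrix.transpose_mul, G.cert_isSymm, hZ, Matrix.transpose_mul, Matrix.transpose_transpose,
      Matrix.transpose_zero] at this
  -- Since `Z * S = 0`, the matrix `Q` may be replaced by `Λ` next to `Z`, after which the
  -- constraints eliminate `Z`.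
  have h1 : (G.Q * (C * Z)).trace = (Λ * C).trace := by
    rw [← Matrix.mul_assoc, Matrix.trace_mul_cycle, hQ, Matrix.mul_add, hZS, zero_add,
      ← Matrix.trace_mul_cycle, trace_mul_of_isRotBlockDiag (hΛr.mul hCr) hU]
  have h2 : (G.Q * (Z * C)).trace = (Λ * C).trace := by
    rw [← Matrix.mul_assoc, hQ, Matrix.add_mul, hSZ, zero_add, Matrix.trace_mul_cycle,
      trace_mul_of_isRotBlockDiag (hCr.mul hΛr) hU, Matrix.trace_mul_comm]
  have h3 : (X * C * G.Q * (X * C).transpose).trace = (G.Q * (C * Z * C)).trace := by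
    rw [Matrix.trace_mul_comm, Matrix.transpose_mul, hCs, hZ, Matrix.trace_mul_comm G.Q]
    simp only [Matrix.mul_assoc]
  have h4 : (C * Λ * C).trace = (Λ * (C * C)).trace := by
    rw [Matrix.mul_assoc, Matrix.trace_mul_comm, Matrix.mul_assoc]
  -- The term `2 tr (Λ C)` cancels the first-order loss in `h1` and `h2`; what remains of the
  -- curvature is `-tr (Λ C²) = tr (C (S - Q) C)`.
  have h5 : w ⬝ᵥ Λ.mulVec w = 2 * (Λ * C).trace - (Λ * (C * C)).trace :=
    geoRow_dotProduct_mulVec hΛr v t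
  have h6 : frob G.Q (Matrix.vecMulVec w w) = w ⬝ᵥ S.mulVec w + w ⬝ᵥ Λ.mulVec w := by
    rw [frob_vecMulVec, hQ, Matrix.add_mulVec, dotProduct_add]
  have h7 : frob G.Q ((1 - C) * Z * (1 - C)) = (G.Q * Z).trace - (G.Q * (C * Z)).trace -
      (G.Q * (Z * C)).trace + (G.Q * (C * Z * C)).trace := by
    rw [frob, Q_isSymm]
    have : (1 - C) * Z * (1 - C) = Z - C * Z - Z * C + C * Z * C := by noncomm_ring
    rw [this]
    simp only [Matrix.mul_add, Matrix.mul_sub, Matrix.trace_add, Matrix.trace_sub]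
  have h8 : frob G.Q ((1 - C) * Z * (1 - C) + Matrix.vecMulVec w w) =
      frob G.Q ((1 - C) * Z * (1 - C)) + frob G.Q (Matrix.vecMulVec w w) := by
    simp [frob, Matrix.mul_add]
  have h9 : G.cost X = (G.Q * Z).trace := by rw [cost, frob, Q_isSymm]
  rw [cost, h.gram_eq t, h8, h7, h6, h3, h5, h1, h2, h9, hCs, hSΛ, Matrix.mul_neg, Matrix.neg_mul,
    Matrix.trace_neg, h4]
  ring

/-- Upper bound for the objective along the geodesic. -/
theorem cost_geodesic_le {X : Factor r d n} (hX : G.IsCritical X) {v : Col d n → ℝ}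
    (hv : v ⬝ᵥ v = 1) {l : ℝ} (hl : (G.cert X).mulVec v = l • v) (hl0 : l ≤ 0)
    {γ : ℝ → Factor (r + 1) d n} (h : IsGeodesicFrom (lift X) (lastRow r v) γ) {t : ℝ}
    (ht : 0 ≤ t) :
    G.cost (γ t) ≤ G.cost X + l * t ^ 2 - l * t ^ 4 / 3 + frobNorm (G.cert X) * (t ^ 6 / 36) +
      (frobNorm (G.cert X) + frobNorm G.Q) * (t ^ 4 / 4) := by
  rw [G.cost_geodesic_eq hX h t]
  set C := rotOuter (cosCoeff v t) v with hC
  set S := G.cert X with hS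
  have hCs : C.transpose = C := rotOuter_transpose _ _
  have hCC : (C * C).trace ≤ t ^ 4 / 4 := trace_sq_cosCoeff_le hv t
  -- The contribution of `-Q` has a favourable sign and is dropped.
  have h1 : (C * (S - G.Q) * C.transpose).trace ≤ frobNorm S * (t ^ 4 / 4) := by
    rw [Matrix.mul_sub, Matrix.sub_mul, Matrix.trace_sub]
    have h2 := trace_mul_mul_transpose_le C S
    have h3 : 0 ≤ (C * G.Q * C.transpose).trace :=
      (G.posSemidef_Q.mul_mul_conjTranspose_same C).trace_nonneg
    have h4 := mul_le_mul_of_nonneg_left hCC (frobNorm_nonneg S)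
    rw [hCs] at *
    linarith
  have h2 : (X * C * G.Q * (X * C).transpose).trace ≤ frobNorm G.Q * (t ^ 4 / 4) := by
    refine (trace_mul_mul_transpose_le _ _).trans
      (mul_le_mul_of_nonneg_left ?_ (frobNorm_nonneg _))
    refine le_of_eq_of_le ?_ hCC
    -- The trace of `X C (X C)ᵀ` is that of `C²`, because `C²` meets only the identity blocks of the
    -- Gram matrix.
    rw [Matrix.transpose_mul, hCs, ← trace_mul_of_isRotBlockDiag
      ((isRotBlockDiag_rotOuter (cosCoeff v t) v).mul (isRotBlockDiag_rotOuter (cosCoeff v t) v))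
      (fun _ _ => gram_apply_of_mem hX.1), ← hC, Matrix.mul_assoc, Matrix.trace_mul_comm]
    simp only [Matrix.mul_assoc]
  -- Expand around the straight line `t v`. As `v` is an eigenvector, the cross term is `-2 t l (v ·
  -- δ)` with `δ = geoDev v t`; since `l ≤ 0`, the bound `v · δ ≤ t³ / 6` gives `-l t⁴ / 3`.
  have h3 : geoRow v t ⬝ᵥ S.mulVec (geoRow v t) ≤
      l * t ^ 2 - l * t ^ 4 / 3 + frobNorm S * (t ^ 6 / 36) := by
    have hsym : v ⬝ᵥ S.mulVec (geoDev v t) = l * (v ⬝ᵥ geoDev v t) := by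
      rw [Matrix.dotProduct_mulVec, ← Matrix.mulVec_transpose, hS, G.cert_isSymm, hl,
        smul_dotProduct, smul_eq_mul]
    have h4 : geoRow v t ⬝ᵥ S.mulVec (geoRow v t) = l * t ^ 2 - 2 * t * l * (v ⬝ᵥ geoDev v t) +
        geoDev v t ⬝ᵥ S.mulVec (geoDev v t) := by
      rw [geoRow_eq, Matrix.mulVec_sub, Matrix.mulVec_smul, hl]
      simp only [sub_dotProduct, dotProduct_sub, smul_dotProduct, dotProduct_smul, smul_eq_mul,
        hsym, hv]
      rw [dotProduct_comm (geoDev v t) v]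
      ring
    have h5 := (le_abs_self _).trans (abs_dotProduct_mulVec_le S (geoDev v t))
    have h6 := mul_le_mul_of_nonneg_left (geoDev_dotProduct_self_le hv ht) (frobNorm_nonneg S)
    have h7 := mul_le_mul_of_nonneg_left (dotProduct_geoDev_le hv ht)
      (mul_nonneg ht (neg_nonneg.mpr hl0))
    rw [h4]
    nlinarith
  linarith

theorem frobNorm_cert_bound {X : Factor r d n} {v : Col d n → ℝ}
    (hv : v ⬝ᵥ v = 1) {l : ℝ} (hl : (G.cert X).mulVec v = l • v) : |l| ≤ frobNorm (G.cert X) := by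
  have := abs_dotProduct_mulVec_le (G.cert X) v
  rwa [hl, dotProduct_smul, hv, smul_eq_mul, mul_one, mul_one] at this

/-- The certificate matrix has a negative eigenvalue only if there are rotations. -/
theorem dim_pos_of_neg_eigenvalue {X : Factor r d n} {v : Col d n → ℝ}
    (hv : v ⬝ᵥ v = 1) {l : ℝ} (hl : (G.cert X).mulVec v = l • v) (hl0 : l < 0) : 0 < d := by
  rcases Nat.eq_zero_or_pos d with rfl | hd
  · exfalso
    have hS : G.cert X = G.Q := by
      rw [cert, sub_eq_self]
      ext c c'
      exact isRotBlockDiag_symBlockDiagPlus _ _ _ fun h => h.2.1 (Subsingleton.elim (α := Fin 1) _ _)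
    have h := G.posSemidef_Q.dotProduct_mulVec_nonneg v
    rw [← hS, hl, star_trivial, dotProduct_smul, hv, smul_eq_mul, mul_one] at h
    linarith
  · exact hd

/-- Guaranteed decrease of the saddle escape. -/
theorem Escape.cost_le {κ τ fbar : ℝ} (hκ : 0 < κ) (hτ : 0 < τ) (hκG : G.kappa fbar ≤ κ)
    {X : Factor r d n} (hX : G.IsCritical X) (hf : G.cost X ≤ fbar) {X' : Factor (r + 1) d n}
    (h : G.Escape κ τ X X') (hneg : minEig (G.cert X) < 0) :
    G.cost X' ≤ G.cost X -
      -minEig (G.cert X) * min (-4 * minEig (G.cert X) / κ) τ ^ 2 / 4 := by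
  obtain ⟨v, γ, hv, hl, hγ, rfl⟩ := h
  rw [cert_lift] at *
  set l := minEig (G.cert X)
  set t := min (-4 * l / κ) τ
  -- For `d = 0` the factor `√(d n)` of `c_s` vanishes, and `kappa` need not dominate `‖S‖`; a
  -- negative eigenvalue excludes this case.
  have hd := G.dim_pos_of_neg_eigenvalue hv hl hneg
  have hn : 0 < n := by
    rcases Nat.eq_zero_or_pos n with rfl | hn
    · simp [dotProduct] at hv
    · exact hn
  have hk := (G.four_mul_le_kappa hX.1 hf hd hn).trans hκG
  have ht : 0 < t := lt_min (div_pos (by linarith) hκ) hτ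
  have htκ : t * κ ≤ -4 * l := (le_div_iff₀ hκ).mp (min_le_left _ _)
  have hlS := G.frobNorm_cert_bound hv hl
  rw [abs_of_neg hneg] at hlS
  have hSn := frobNorm_nonneg (G.cert X)
  have hQn := frobNorm_nonneg G.Q
  -- If `t > 1`, then `κ < t κ ≤ -4 l ≤ 4 ‖S‖ ≤ κ`.
  have ht1 : t ≤ 1 := by
    by_contra! hlt
    nlinarith
  have hb := G.cost_geodesic_le hX hv hl hneg.le hγ ht.le
  refine hb.trans ?_
  set s := frobNorm (G.cert X)
  set q := frobNorm G.Q
  have e1 : t * (s + q) ≤ -l := by nlinarith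
  have p2 : t ^ 4 ≤ t ^ 2 := pow_le_pow_of_le_one ht.le ht1 (by norm_num)
  have p3 : t ^ 3 ≤ t ^ 2 := pow_le_pow_of_le_one ht.le ht1 (by norm_num)
  have p5 : t ^ 5 ≤ t ^ 2 := pow_le_pow_of_le_one ht.le ht1 (by norm_num)
  have a1 : -l * t ^ 4 ≤ -l * t ^ 2 := mul_le_mul_of_nonneg_left p2 (by linarith)
  have a2 : (s + q) * t ^ 4 ≤ -l * t ^ 2 := by
    calc (s + q) * t ^ 4 = t * (s + q) * t ^ 3 := by ring
      _ ≤ -l * t ^ 3 := mul_le_mul_of_nonneg_right e1 (by positivity)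
      _ ≤ _ := mul_le_mul_of_nonneg_left p3 (by linarith)
  have a3 : s * t ^ 6 ≤ -l * t ^ 2 := by
    calc s * t ^ 6 ≤ (s + q) * t ^ 6 := mul_le_mul_of_nonneg_right (by linarith) (by positivity)
      _ = t * (s + q) * t ^ 5 := by ring
      _ ≤ -l * t ^ 5 := mul_le_mul_of_nonneg_right e1 (by positivity)
      _ ≤ _ := mul_le_mul_of_nonneg_left p5 (by linarith)
  have a4 : 0 ≤ -l * t ^ 2 := mul_nonneg (by linarith) (sq_nonneg t)
  -- The errors add up to at most `1/3 + 1/36 + 1/4 = 11/18` of `-l t²`, which leaves `7/18 ≥ 1/4`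
  -- of the gain.
  linarith

end PoseGraph

/-! ### Convergence of infinite runs -/

namespace PoseGraph

variable {d n : ℕ} {G : PoseGraph d n} {r₀ : ℕ} {X₀ : Factor r₀ d n} {κ τ : ℝ}

theorem Run.isCritical (R : G.Run X₀ κ τ) {k : ℕ} (hk : G.Reached R.crit k) :
    G.IsCritical (R.crit k) := (R.localSearch k hk).1

theorem Run.cost_X (R : G.Run X₀ κ τ) (k : ℕ) : G.cost (R.X k) = G.cost (R.crit k) :=
  G.cost_lift _

theorem Run.cert_X (R : G.Run X₀ κ τ) (k : ℕ) : G.cert (R.X k) = G.cert (R.crit k) :=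
  G.cert_lift _

theorem Run.isSDPMinimizer (R : G.Run X₀ κ τ) {k : ℕ} (h : R.ReturnsAt k) :
    G.IsSDPMinimizer ((R.X k).transpose * R.X k) := by
  rw [Run.X, gram_lift]
  refine G.isSDPMinimizer_of_minEig_nonneg (R.isCritical h.1) ?_
  rw [← R.cert_X]
  exact h.2

/-- Strong induction: if the test failed at all earlier levels, level `k` is reached, and not
stopping there means that the test fails again. -/
theorem Run.minEig_neg (R : G.Run X₀ κ τ) (h : ∀ k, ¬ R.ReturnsAt k) (k : ℕ) :
    minEig (G.cert (R.X k)) < 0 := by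
  induction k using Nat.strong_induction_on with
  | _ k ih =>
    by_contra! h0
    exact h k ⟨ih, h0⟩

theorem Run.reached (R : G.Run X₀ κ τ) (h : ∀ k, ¬ R.ReturnsAt k) (k : ℕ) :
    G.Reached R.crit k := fun j _ => R.minEig_neg h j

theorem Run.cost_succ_le (R : G.Run X₀ κ τ) (hκ : 0 < κ) (hτ : 0 < τ)
    (hκR : G.kappa (G.cost (R.X 0)) ≤ κ) (h : ∀ k, ¬ R.ReturnsAt k) {k : ℕ}
    (hf : G.cost (R.X k) ≤ G.cost (R.X 0)) :
    G.cost (R.X (k + 1)) ≤ G.cost (R.X k) - -minEig (G.cert (R.X k)) *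
      min (-4 * minEig (G.cert (R.X k)) / κ) τ ^ 2 / 4 := by
  have hneg := R.minEig_neg h k
  have he := R.escape k (R.reached h k) hneg
  rw [R.cost_X] at hf
  rw [R.cert_X] at hneg
  have h1 := he.cost_le G hκ hτ hκR (R.isCritical (R.reached h k)) hf hneg
  rw [R.cost_X (k + 1), R.cost_X k, R.cert_X]
  exact (R.localSearch (k + 1) (R.reached h (k + 1))).2.trans h1

theorem escape_decrease_pos {l : ℝ} (hl : l < 0) (hκ : 0 < κ) (hτ : 0 < τ) :
    0 < -l * min (-4 * l / κ) τ ^ 2 / 4 := by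
  have : 0 < min (-4 * l / κ) τ := lt_min (div_pos (by linarith) hκ) hτ
  have : 0 < -l := by linarith
  positivity

theorem Run.strictAnti_cost (R : G.Run X₀ κ τ) (hκ : 0 < κ) (hτ : 0 < τ)
    (hκR : G.kappa (G.cost (R.X 0)) ≤ κ) (h : ∀ k, ¬ R.ReturnsAt k) :
    StrictAnti fun k => G.cost (R.X k) := by
  -- The constant `κ` is adapted to the sublevel set of the first critical point, so staying in this
  -- set has to be propagated along with the decrease.
  have hle : ∀ k, G.cost (R.X k) ≤ G.cost (R.X 0) := by
    intro k
    induction k with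
    | zero => exact le_rfl
    | succ k ih =>
      have h1 := R.cost_succ_le hκ hτ hκR h ih
      have h2 := escape_decrease_pos (R.minEig_neg h k) hκ hτ
      linarith
  refine strictAnti_nat_of_succ_lt fun k => ?_
  have h1 := R.cost_succ_le hκ hτ hκR h (hle k)
  have h2 := escape_decrease_pos (R.minEig_neg h k) hκ hτ
  linarith

/-- The least eigenvalues of the certificate matrices tend to zero along a run that never stops. -/
theorem Run.tendsto_minEig (R : G.Run X₀ κ τ) (hκ : 0 < κ) (hτ : 0 < τ)
    (hκR : G.kappa (G.cost (R.X 0)) ≤ κ) (h : ∀ k, ¬ R.ReturnsAt k) {L : ℝ}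
    (hL : Filter.Tendsto (fun k => G.cost (R.X k)) Filter.atTop (nhds L)) :
    Filter.Tendsto (fun k => minEig (G.cert (R.X k))) Filter.atTop (nhds 0) := by
  have hanti := R.strictAnti_cost hκ hτ hκR h
  have hdiff : Filter.Tendsto (fun k => G.cost (R.X k) - G.cost (R.X (k + 1))) Filter.atTop
      (nhds 0) := by
    simpa using hL.sub (hL.comp (Filter.tendsto_add_atTop_nat 1))
  rw [Metric.tendsto_atTop]
  intro ε hε
  -- This is the guaranteed decrease for the eigenvalue `-ε`. It grows with `-λ`, so `λ ≤ -ε` at a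
  -- late level would contradict that consecutive costs differ by less.
  have hδ : 0 < - -ε * min (-4 * -ε / κ) τ ^ 2 / 4 :=
    escape_decrease_pos (neg_neg_of_pos hε) hκ hτ
  obtain ⟨K, hK⟩ := Filter.eventually_atTop.mp (hdiff.eventually_lt_const hδ)
  refine ⟨K, fun k hk => ?_⟩
  have hneg := R.minEig_neg h k
  rw [Real.dist_eq, sub_zero, abs_of_neg hneg]
  by_contra! hge
  have h1 := R.cost_succ_le hκ hτ hκR h (hanti.antitone (Nat.zero_le k))
  have h2 := hK k hk
  have h3 : min (-4 * -ε / κ) τ ≤ min (-4 * minEig (G.cert (R.X k)) / κ) τ :=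
    min_le_min_right _ (div_le_div_of_nonneg_right (by linarith) hκ.le)
  have h4 : 0 ≤ min (-4 * -ε / κ) τ := le_min (div_nonneg (by linarith) hκ.le) hτ.le
  have h5 : ε * min (-4 * -ε / κ) τ ^ 2 ≤ -minEig (G.cert (R.X k)) *
      min (-4 * minEig (G.cert (R.X k)) / κ) τ ^ 2 :=
    mul_le_mul hge (pow_le_pow_left₀ h4 h3 2) (sq_nonneg _) (by linarith)
  rw [neg_neg] at h2
  linarith

/-- The objective tends to a limit, and the limit is the optimal value of the SDP. -/
theorem Run.tendsto_cost (R : G.Run X₀ κ τ) (hκ : 0 < κ) (hτ : 0 < τ)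
    (hκR : G.kappa (G.cost (R.X 0)) ≤ κ) (h : ∀ k, ¬ R.ReturnsAt k) :
    Filter.Tendsto (fun k => G.cost (R.X k)) Filter.atTop (nhds G.sdpValue) := by
  have hcrit := fun k => R.isCritical (R.reached h k)
  have hlow : ∀ k, G.sdpValue ≤ G.cost (R.X k) := fun k => by
    rw [R.cost_X]
    exact G.sdpValue_le_cost (hcrit k).1
  have hL := tendsto_atTop_ciInf (R.strictAnti_cost hκ hτ hκR h).antitone
    ⟨G.sdpValue, by rintro _ ⟨k, rfl⟩; exact hlow k⟩
  set L := ⨅ k, G.cost (R.X k)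
  have hmin := R.tendsto_minEig hκ hτ hκR h hL
  have hle : L ≤ G.sdpValue := by
    refine le_csInf ⟨_, _, gram_mem_sdpFeasible (hcrit 0).1, rfl⟩ ?_
    rintro _ ⟨Z, hZ, rfl⟩
    -- With `Z` fixed its trace is a constant, so weak duality passes to the limit without
    -- compactness of the iterates or attainment of the infimum.
    have hlim := hL.add (hmin.mul_const Z.trace)
    rw [zero_mul, add_zero] at hlim
    refine le_of_tendsto' hlim fun k => ?_
    rw [R.cost_X, R.cert_X]
    exact G.cost_add_minEig_le (hcrit k) hZ
  rwa [le_antisymm hle (ge_of_tendsto' hL hlow)] at hL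

end PoseGraph

end PGO

end

theorem theorem3 {d n : ℕ} (G : PGO.PoseGraph d n)
    {r₀ : ℕ} (X₀ : PGO.Factor r₀ d n) (hX₀ : X₀ ∈ PGO.manifold r₀ d n)
    (κ τ : ℝ) (hκ : 0 < κ) (hτ : 0 < τ) (R : G.Run X₀ κ τ)
    (hκR : G.kappa (G.cost (R.X 0)) ≤ κ) :
    Xor
      (∃ k, R.ReturnsAt k ∧ G.IsSDPMinimizer ((R.X k).transpose * R.X k))
      ((∀ k, ¬ R.ReturnsAt k) ∧
        (∀ k₁ k₂, k₁ < k₂ → G.cost (R.X k₂) < G.cost (R.X k₁)) ∧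
        Filter.Tendsto (fun k => G.cost (R.X k)) Filter.atTop (nhds G.sdpValue) ∧
        ∃ φ : ℕ → ℕ, StrictMono φ ∧
          Filter.Tendsto (fun k => PGO.minEig (G.cert (R.X (φ k)))) Filter.atTop (nhds 0)) := by
  by_cases h : ∃ k, R.ReturnsAt k
  · obtain ⟨k, hk⟩ := h
    exact Or.inl ⟨⟨k, hk, R.isSDPMinimizer hk⟩, fun h' => h'.1 k hk⟩
  · have h' := not_exists.mp h
    have hcost := R.tendsto_cost hκ hτ hκR h'
    -- The whole sequence of least eigenvalues tends to zero, so the identity serves as the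
    -- subsequence.
    exact Or.inr ⟨⟨h', fun _ _ hlt => R.strictAnti_cost hκ hτ hκR h' hlt, hcost, id,
      strictMono_id, R.tendsto_minEig hκ hτ hκR h' hcost⟩, fun ⟨k, hk, _⟩ => h ⟨k, hk⟩⟩
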